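/- **Setting.** Let $\Omega\subset\mathbb R^3$ be open and connected with $\Omega=\operatorname{int}\overline\Omega$, and let $\mathcal T_h$ be a conforming triangulation of $\overline\Omega$ by finitely many tetrahedra (for instance, $\Omega$ a connected polyhedral Lipschitz domain). Let $\Gamma=\partial\Omega$, let $\Gamma_h$ be the set of boundary faces and $\boldsymbol n$ the outward unit normal. Let $\mu,\kappa\in L^\infty(\Omega;\mathbb R^{3\times3})$ be symmetric and uniformly positive definite, $\omega\in\mathbb R\setminus\{0\}$, $\alpha,\beta>0$, $u_d\in L^2(\Omega;\mathbb C^3)$ and $0\le j\le k$ integers. Inner products are linear in the first and conjugate-linear in the second argument. Put $$a(u,v)=(\mu^{-1}\nabla\times u,\nabla\times v)_{0,\Omega}+\mathrm i\omega\,(\kappa u,v)_{0,\Omega},\qquad a^*(w,v)=\overline{a(v,w)} .$$ Let $\mathcal N_k^h\subset H(\mathrm{curl};\Omega)$ be the complex Nédélec space of the first family of order $k$ ($k=0$ is the lowest order): on each tetrahedron its elements lie in $(P_k)^3\oplus\{q\in(\widetilde P_{k+1})^3: x\cdot q=0\}$, with $\widetilde P$ the homogeneous polynomials, and their tangential components are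 continuous across interior faces. Let $\mathcal N_{k0}^h=\{v\in\mathcal N_k^h: v\times \boldsymbol n=0\text{ on }\Gamma\}$. With $\gamma_Tu=\boldsymbol n\times(u\times \boldsymbol n)$ and $\mathrm{curl}_\Gamma z=\boldsymbol n\cdot(\nabla\times z)$ on each face, the discrete control space is $$Z^h=\Big\{z\in\gamma_T\mathcal N_j^h:\ \int_\Gamma \mathrm{curl}_\Gamma z\,dS=0\Big\}.$$ For $z\in Z^h$ let $S_hz\in\mathcal N_k^h$ be the solution $u$ of $a(u,v)=0$ for all $v\in\mathcal N_{k0}^h$, $u\times \boldsymbol n=z\times \boldsymbol n$ on $\Gamma$, and let $$j_h(z)=\tfrac12\|S_hz-u_d\|_{0,\Omega}^2+\tfrac\alpha2\|\mathrm{curl}_\Gamma z\|_{0,\Gamma}^2+\tfrac\beta2\|z\|_{0,\Gamma}^2 .$$ The discrete adjoint $S_h^*$ is defined by $\langle S_h^*f,\xi\rangle=(f,S_h\xi)_{0,\Omega}$ for $\xi\in Z^h$. For $\xi\in Z^h$ let $L_h\xi\in\mathcal N_k^h$ be the element that has the same local two-dimensional Nédélec moments (edge moments against $P_k$, face moments against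 tangential fields in $P_{k-1}$) as $\xi$ on all edges and faces of $\Gamma_h$, and whose interior moments all vanish. **Theorem.** 1. For every $z\in Z^h$ the discrete state $S_hz$ exists and is unique, and the discrete adjoint problem: find $w_h\in\mathcal N_{k0}^h$ with $a^*(w_h,v)=(S_hz-u_d,v)_{0,\Omega}$ for all $v\in\mathcal N_{k0}^h$, has a unique solution. 2. For all $z,\xi\in Z^h$, with this $w_h$, $$\langle S_h^*(S_hz-u_d),\xi\rangle=-\overline{a(L_h\xi,w_h)}+(S_hz-u_d,L_h\xi)_{0,\Omega},$$ and the same holds with $L_h\xi$ replaced by any $\ell\in\mathcal N_k^h$ that shares with $\xi$ the moments on the edges and faces of $\Gamma_h$. 3. A control $\bar z_h\in Z^h$ minimizes $j_h$ over $Z^h$ if and only if, with $\bar u_h=S_h\bar z_h$, $$\mathrm{Re}\Big\{\langle S_h^*(\bar u_h-u_d),z_h-\bar z_h\rangle+\alpha(\mathrm{curl}_\Gamma\bar z_h,\mathrm{curl}_\Gamma(z_h-\bar z_h))_{0,\Gamma}+\beta(\bar z_h,z_h-\bar z_h)_{0,\Gamma}\Big\}=0\qquad\forall z_h\in Z^h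 .$$ -/

import Mathlib

open MeasureTheory MvPolynomial
open scoped Matrix ComplexConjugate

noncomputable section

namespace EddyControl

/-- Physical space `ℝ³` with its Euclidean structure. -/
abbrev E3 : Type := EuclideanSpace ℝ (Fin 3)

/-- Complex polynomial vector fields on `ℝ³`. -/
abbrev PolyField : Type := Fin 3 → MvPolynomial (Fin 3) ℂ

/-- A real vector, regarded as a complex one. -/
def toC (x : E3) : Fin 3 → ℂ := fun i => ((x i : ℝ) : ℂ)

/-- Value of a polynomial at a point of `ℝ³`. -/
def peval (p : MvPolynomial (Fin 3) ℂ) (x : E3) : ℂ := MvPolynomial.eval (toC x) p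

/-- Value of a polynomial vector field at a point of `ℝ³`. -/
def feval (p : PolyField) (x : E3) : Fin 3 → ℂ := fun i => peval (p i) x

/-- The curl of a polynomial vector field. -/
def pcurl (p : PolyField) : PolyField :=
  ![pderiv 1 (p 2) - pderiv 2 (p 1),
    pderiv 2 (p 0) - pderiv 0 (p 2),
    pderiv 0 (p 1) - pderiv 1 (p 0)]

/-- The local Nédélec space (first family) of order `k` (`k = 0` is the lowest order):
`(P_k)³ ⊕ {q ∈ (P̃_{k+1})³ : x · q = 0}`, with `P̃` the homogeneous polynomials. -/
def localNedelec (k : ℕ) : Submodule ℂ PolyField :=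
  Submodule.pi Set.univ (fun _ => MvPolynomial.restrictTotalDegree (Fin 3) ℂ k) ⊔
    (Submodule.pi Set.univ (fun _ => MvPolynomial.homogeneousSubmodule (Fin 3) ℂ (k + 1)) ⊓
      LinearMap.ker (∑ i : Fin 3,
        (LinearMap.mulLeft ℂ (X i : MvPolynomial (Fin 3) ℂ)) ∘ₗ
          (LinearMap.proj i : PolyField →ₗ[ℂ] MvPolynomial (Fin 3) ℂ)))

/-- A conforming triangulation of `Ω` by finitely many closed tetrahedra: a finite simplicial
complex in which every simplex is a face of a tetrahedron, and whose union is the closure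
of `Ω`. -/
structure Triangulation (Ω : Set E3) where
  /-- the simplices, each given by its set of vertices -/
  complex : Geometry.SimplicialComplex ℝ E3
  finite : complex.faces.Finite
  pure : ∀ s ∈ complex.faces, ∃ t ∈ complex.faces, s ⊆ t ∧ t.card = 4
  space_eq : complex.space = closure Ω

namespace Triangulation

variable {Ω : Set E3} (T : Triangulation Ω)

/-- The closed simplex spanned by a finite set of points. -/
def hull (s : Finset E3) : Set E3 := convexHull ℝ (s : Set E3)

/-- The tetrahedra of the mesh. -/
def cells : Finset (Finset E3) := T.finite.toFinset.filter (fun s => s.card = 4)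

open Classical in
/-- The set `Γ_h` of the triangular faces that lie on the boundary of `Ω`. -/
def bfaces : Finset (Finset E3) :=
  T.finite.toFinset.filter (fun s => s.card = 3 ∧ hull s ⊆ frontier Ω)

theorem exists_adj (F : T.bfaces) : ∃ K : T.cells, F.1 ⊆ K.1 := by
  have hF : F.1 ∈ T.complex.faces := by
    have h := F.2
    simp only [bfaces, Finset.mem_filter, Set.Finite.mem_toFinset] at h
    exact h.1
  obtain ⟨t, ht, hst, hc⟩ := T.pure F.1 hF
  exact ⟨⟨t, by simp [cells, ht, hc]⟩, hst⟩

/-- The tetrahedron adjacent to a boundary face. -/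
def adj (F : T.bfaces) : T.cells := (T.exists_adj F).choose

theorem bface_nonempty (F : T.bfaces) : F.1.Nonempty := by
  have h := F.2
  simp only [bfaces, Finset.mem_filter] at h
  exact Finset.card_pos.mp (by omega)

/-- The outward unit normal of a boundary face: the unit vector that is orthogonal to the face
and points away from the remaining vertex of the adjacent tetrahedron. -/
def normal (F : T.bfaces) : E3 :=
  Classical.epsilon fun n : E3 =>
    ‖n‖ = 1 ∧ (∀ a ∈ F.1, ∀ b ∈ F.1, inner ℝ n (b - a) = 0) ∧
      ∀ a ∈ F.1, ∀ p ∈ (T.adj F).1, p ∉ F.1 → inner ℝ n (p - a) < 0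

/-- Piecewise polynomial vector fields, one polynomial field for each tetrahedron. -/
abbrev Field : Type := T.cells → PolyField

/-- Vector fields on `Γ`, one polynomial field for each boundary face. -/
abbrev BField : Type := T.bfaces → PolyField

/-- The Nédélec finite element space `N_k^h`: on each tetrahedron the field belongs to the local
Nédélec space, and its tangential components are continuous across common triangular faces of
two tetrahedra, which is conformity in `H(curl; Ω)`. -/
def nedelec (k : ℕ) : Submodule ℂ T.Field where
  carrier := {u | (∀ K, u K ∈ localNedelec k) ∧
    ∀ (K K' : T.cells) (F : Finset E3), F.card = 3 → F ⊆ K.1 → F ⊆ K'.1 →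
      ∀ x ∈ hull F, ∀ a ∈ F, ∀ b ∈ F,
        feval (u K) x ⬝ᵥ toC (b - a) = feval (u K') x ⬝ᵥ toC (b - a)}
  zero_mem' := ⟨fun _ => Submodule.zero_mem _, fun _ _ _ _ _ _ _ _ _ _ _ _ => rfl⟩
  add_mem' := by
    rintro u v ⟨hu, hu'⟩ ⟨hv, hv'⟩
    have key : ∀ (K : T.cells) (x : E3), feval ((u + v) K) x = feval (u K) x + feval (v K) x :=
      fun K x => funext fun i => by simp [feval, peval]
    refine ⟨fun K => Submodule.add_mem _ (hu K) (hv K), ?_⟩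
    intro K K' F h1 h2 h3 x hx a ha b hb
    rw [key, key, add_dotProduct, add_dotProduct, hu' K K' F h1 h2 h3 x hx a ha b hb,
      hv' K K' F h1 h2 h3 x hx a ha b hb]
  smul_mem' := by
    rintro c u ⟨hu, hu'⟩
    have key : ∀ (K : T.cells) (x : E3), feval ((c • u) K) x = c • feval (u K) x :=
      fun K x => funext fun i => by simp [feval, peval, smul_eval]
    refine ⟨fun K => Submodule.smul_mem _ c (hu K), ?_⟩
    intro K K' F h1 h2 h3 x hx a ha b hb
    rw [key, key, smul_dotProduct, smul_dotProduct, hu' K K' F h1 h2 h3 x hx a ha b hb]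

/-- `N_{k0}^h`: the elements `u` of `N_k^h` with `u × n = 0` on `Γ`. -/
def nedelec0 (k : ℕ) : Set T.Field :=
  {u | u ∈ T.nedelec k ∧ ∀ F : T.bfaces, ∀ x ∈ hull F.1,
    feval (u (T.adj F)) x ⨯₃ toC (T.normal F) = 0}

/-- The field on `ℝ³` that is constant in the direction normal to the boundary face `F` and
agrees with `p` on the plane of `F`. A field on `F` is represented by the polynomial field that
is constant along the normal, so that the representing polynomials are unique. -/
def normalExt (F : T.bfaces) (p : PolyField) : PolyField :=
  let n := T.normal F
  let a := (T.bface_nonempty F).choose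
  fun i => bind₁ (fun l => X l - C ((n l : ℝ) : ℂ) *
    ∑ m : Fin 3, C ((n m : ℝ) : ℂ) * (X m - C ((a m : ℝ) : ℂ))) (p i)

/-- The tangential trace `γ_T u = n × (u × n)` on each boundary face. -/
def gammaT (u : T.Field) : T.BField := fun F =>
  let n : PolyField := fun i => C ((T.normal F i : ℝ) : ℂ)
  n ⨯₃ (T.normalExt F (u (T.adj F)) ⨯₃ n)

/-- The surface curl `n · (∇ × z)`, face by face. -/
def surfCurl (z : T.BField) (F : T.bfaces) : MvPolynomial (Fin 3) ℂ :=
  ∑ i : Fin 3, C ((T.normal F i : ℝ) : ℂ) * pcurl (z F) i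

/-- The discrete control space `Z^h`: tangential traces of elements of `N_j^h` whose surface curl
has zero mean on `Γ`. -/
def Zh (j : ℕ) : Set T.BField :=
  {z | (∃ u ∈ T.nedelec j, T.gammaT u = z) ∧
    ∑ F : T.bfaces, ∫ x in hull F.1, peval (T.surfCurl z F) x ∂(μHE[2] : Measure E3) = 0}

/-- The `L²(Ω; ℂ³)` inner product (linear in the first argument) of two fields that are given
tetrahedron by tetrahedron. -/
def innerΩ (f g : T.cells → E3 → Fin 3 → ℂ) : ℂ :=
  ∑ K : T.cells, ∫ x in hull K.1, f K x ⬝ᵥ star (g K x)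

/-- A finite element field as a field of functions. -/
def fn (u : T.Field) : T.cells → E3 → Fin 3 → ℂ := fun K x => feval (u K) x

/-- The `L²(Γ; ℂ³)` inner product. -/
def innerΓ (z y : T.BField) : ℂ :=
  ∑ F : T.bfaces, ∫ x in hull F.1, feval (z F) x ⬝ᵥ star (feval (y F) x) ∂(μHE[2] : Measure E3)

/-- The `L²(Γ; ℂ)` inner product of two surface curls. -/
def innerCurlΓ (z y : T.BField) : ℂ :=
  ∑ F : T.bfaces, ∫ x in hull F.1,
    peval (T.surfCurl z F) x * conj (peval (T.surfCurl y F) x) ∂(μHE[2] : Measure E3)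

/-- The sesquilinear form
`a(u, v) = (μ⁻¹ curl u, curl v)_{0,Ω} + i ω (κ u, v)_{0,Ω}`. -/
def aForm (μ κ : E3 → Matrix (Fin 3) (Fin 3) ℝ) (ω : ℝ) (u v : T.Field) : ℂ :=
  T.innerΩ (fun K x => (μ x)⁻¹.map (algebraMap ℝ ℂ) *ᵥ feval (pcurl (u K)) x)
      (fun K x => feval (pcurl (v K)) x) +
    Complex.I * (ω : ℂ) *
      T.innerΩ (fun K x => (κ x).map (algebraMap ℝ ℂ) *ᵥ feval (u K) x) (T.fn v)

/-- The adjoint form `a*(w, v) = conj (a(v, w))`. -/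
def aStar (μ κ : E3 → Matrix (Fin 3) (Fin 3) ℝ) (ω : ℝ) (w v : T.Field) : ℂ :=
  conj (T.aForm μ κ ω v w)

/-- `u` solves the discrete state equation with boundary datum `z`: it belongs to `N_k^h`,
`a(u, v) = 0` for all `v ∈ N_{k0}^h`, and `u × n = z × n` on `Γ`. -/
def IsDiscreteState (k : ℕ) (μ κ : E3 → Matrix (Fin 3) (Fin 3) ℝ) (ω : ℝ)
    (z : T.BField) (u : T.Field) : Prop :=
  u ∈ T.nedelec k ∧ (∀ v ∈ T.nedelec0 k, T.aForm μ κ ω u v = 0) ∧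
    ∀ F : T.bfaces, ∀ x ∈ hull F.1,
      feval (u (T.adj F)) x ⨯₃ toC (T.normal F) = feval (z F) x ⨯₃ toC (T.normal F)

/-- The discrete solution operator `S_h`. -/
def Sh (k : ℕ) (μ κ : E3 → Matrix (Fin 3) (Fin 3) ℝ) (ω : ℝ) (z : T.BField) : T.Field :=
  Classical.epsilon (T.IsDiscreteState k μ κ ω z)

/-- The field `u - u_d`. -/
def residual (ud : E3 → Fin 3 → ℂ) (u : T.Field) : T.cells → E3 → Fin 3 → ℂ :=
  fun K x => feval (u K) x - ud x

/-- The cost functional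
`J(u, z) = ½ ‖u - u_d‖²_{0,Ω} + (α/2) ‖curl_Γ z‖²_{0,Γ} + (β/2) ‖z‖²_{0,Γ}`. -/
def cost (α β : ℝ) (ud : E3 → Fin 3 → ℂ) (u : T.Field) (z : T.BField) : ℝ :=
  1 / 2 * (∑ K : T.cells, ∫ x in hull K.1, ∑ i, ‖T.residual ud u K x i‖ ^ 2) +
    α / 2 * (∑ F : T.bfaces, ∫ x in hull F.1,
      ‖peval (T.surfCurl z F) x‖ ^ 2 ∂(μHE[2] : Measure E3)) +
    β / 2 * (∑ F : T.bfaces, ∫ x in hull F.1,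
      ∑ i, ‖feval (z F) x i‖ ^ 2 ∂(μHE[2] : Measure E3))

/-- The reduced discrete cost functional `j_h(z) = J(S_h z, z)`. -/
def reducedCost (k : ℕ) (μ κ : E3 → Matrix (Fin 3) (Fin 3) ℝ) (ω α β : ℝ)
    (ud : E3 → Fin 3 → ℂ) (z : T.BField) : ℝ :=
  T.cost α β ud (T.Sh k μ κ ω z) z

/-- `w` solves the discrete adjoint problem with right-hand side `f`: `w ∈ N_{k0}^h` and
`a*(w, v) = (f, v)_{0,Ω}` for all `v ∈ N_{k0}^h`. -/
def IsDiscreteAdjoint (k : ℕ) (μ κ : E3 → Matrix (Fin 3) (Fin 3) ℝ) (ω : ℝ)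
    (f : T.cells → E3 → Fin 3 → ℂ) (w : T.Field) : Prop :=
  w ∈ T.nedelec0 k ∧ ∀ v ∈ T.nedelec0 k, T.aStar μ κ ω w v = T.innerΩ f (T.fn v)

/-- The adjoint `S_h^*` of the discrete solution operator:
`⟨S_h^* f, ξ⟩ = (f, S_h ξ)_{0,Ω}`. -/
def ShAdjoint (k : ℕ) (μ κ : E3 → Matrix (Fin 3) (Fin 3) ℝ) (ω : ℝ)
    (f : T.cells → E3 → Fin 3 → ℂ) (ξ : T.BField) : ℂ :=
  T.innerΩ f (T.fn (T.Sh k μ κ ω ξ))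

/-- Edge moment `∫_e (v · (b - a)) q ds` on the edge `e` from `a` to `b`. -/
def edgeMoment (v : PolyField) (a b : E3) (q : MvPolynomial (Fin 3) ℂ) : ℂ :=
  ∫ x in segment ℝ a b, (feval v x ⬝ᵥ toC (b - a)) * peval q x ∂(μHE[1] : Measure E3)

/-- Face moment `∫_F (v · (b - a)) q dS` of `v` against the tangential field `q (b - a)`,
where `a`, `b` are vertices of `F`. -/
def faceMoment (v : PolyField) (F : Finset E3) (a b : E3) (q : MvPolynomial (Fin 3) ℂ) : ℂ :=
  ∫ x in hull F, (feval v x ⬝ᵥ toC (b - a)) * peval q x ∂(μHE[2] : Measure E3)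

/-- `u ∈ N_k^h` has the same local two-dimensional Nédélec moments as `z` on all edges (against
`P_k`) and all faces (against tangential fields in `P_{k-1}`) of `Γ_h`. -/
def SharesBoundaryMoments (k : ℕ) (z : T.BField) (u : T.Field) : Prop :=
  u ∈ T.nedelec k ∧ ∀ F : T.bfaces, ∀ a ∈ F.1, ∀ b ∈ F.1,
    (∀ q : MvPolynomial (Fin 3) ℂ, q.totalDegree ≤ k →
      edgeMoment (u (T.adj F)) a b q = edgeMoment (z F) a b q) ∧
    (∀ q : MvPolynomial (Fin 3) ℂ, q.totalDegree < k →
      faceMoment (u (T.adj F)) F.1 a b q = faceMoment (z F) F.1 a b q)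

/-- All interior Nédélec moments of `u` vanish: those on edges and faces that are not contained
in `Γ`, and those on tetrahedra (against `P_{k-2}`). -/
def HasZeroInteriorMoments (k : ℕ) (u : T.Field) : Prop :=
  ∀ K : T.cells,
    (∀ a ∈ K.1, ∀ b ∈ K.1, (¬ ∃ F ∈ T.bfaces, a ∈ F ∧ b ∈ F) →
      ∀ q : MvPolynomial (Fin 3) ℂ, q.totalDegree ≤ k → edgeMoment (u K) a b q = 0) ∧
    (∀ F : Finset E3, F.card = 3 → F ⊆ K.1 → F ∉ T.bfaces → ∀ a ∈ F, ∀ b ∈ F,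
      ∀ q : MvPolynomial (Fin 3) ℂ, q.totalDegree < k → faceMoment (u K) F a b q = 0) ∧
    (∀ q : PolyField, (∀ i, (q i).totalDegree + 2 ≤ k) →
      ∫ x in hull K.1, feval (u K) x ⬝ᵥ feval q x = 0)

open Classical in
/-- The boundary lifting `L_h`: the element of `N_k^h` that shares the boundary moments of `z` and
has zero interior moments. The second branch only serves to make the definition total. -/
def Lh (k : ℕ) (z : T.BField) : T.Field :=
  if h : ∃ u, T.SharesBoundaryMoments k z u ∧ T.HasZeroInteriorMoments k u then h.choose
  else Classical.epsilon (T.SharesBoundaryMoments k z)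

/-- The value `-conj (a(ℓ, w)) + (f, ℓ)_{0,Ω}`, by which `⟨S_h^* f, ξ⟩` is computed from the
discrete adjoint state `w` and a lifting `ℓ` of `ξ`. -/
def adjointFormula (μ κ : E3 → Matrix (Fin 3) (Fin 3) ℝ) (ω : ℝ)
    (f : T.cells → E3 → Fin 3 → ℂ) (w l : T.Field) : ℂ :=
  -conj (T.aForm μ κ ω l w) + T.innerΩ f (T.fn l)

end Triangulation

/-- `M` is a coefficient in `L^∞(Ω; ℝ^{3×3})` that is symmetric and uniformly positive
definite. -/
structure IsCoefficient (Ω : Set E3) (M : E3 → Matrix (Fin 3) (Fin 3) ℝ) : Prop where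
  bounded : ∀ i j, MemLp (fun x => M x i j) ⊤ (volume.restrict Ω)
  symm : ∀ᵐ x ∂(volume.restrict Ω), (M x).IsSymm
  pos : ∃ c : ℝ, 0 < c ∧ ∀ᵐ x ∂(volume.restrict Ω), ∀ v : Fin 3 → ℝ, c * (v ⬝ᵥ v) ≤ v ⬝ᵥ M x *ᵥ v

end EddyControl

end

/-! Solvability needs only definiteness of `aForm`. Since μ⁻¹ and κ are symmetric, both terms `(μ⁻¹
curl u, curl u)` and `(κ u, u)` are real, so the imaginary part of a(u,u) is ω (κu,u). As ω ≠ 0,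
a(u,u) = 0 forces ‖u‖ = 0, and a piecewise polynomial field of norm zero is zero (`aForm_definite`).
On the finite-dimensional space N_{k0}^h a definite sesquilinear form represents every
conjugate-linear functional (`IsSesq.exists_represent`), and so does its adjoint form. The state is
a field with trace z plus a correction in N_{k0}^h.

For the adjoint formula let u = S_h ξ, let ℓ share its boundary moments, and put f = S_h z - u_d. If
u - ℓ lies in N_{k0}^h it is a test function for the adjoint problem, and (f, u - ℓ) = conj a(u - ℓ,
w) = -conj a(ℓ, w), because a(u, w) = 0.

That u - ℓ has zero tangential trace is the unisolvence of the planar Nédélec element, and is the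
substantial part. On an edge the tangential component has degree at most k and is tested against its
own conjugate. On the reference triangle, with λ = 1 - x - y, a field (f₁, f₂) without tangential
trace on the edges has the form f₁ = y(x(m+n) + λm), f₂ = x(y(m+n) + λn) with m, n of degree below k
(`exists_bubble_representation`). Testing against conj m and conj n gives the integral of xy|m+n|² +
yλ|m|² + xλ|n|². All terms are nonnegative, so m = n = 0.

Uniqueness makes S_h linear, so along a line in Z^h the cost is j_h(z) + t g + t² Q with Q ≥ 0.
Since Z^h is a subspace, minimality is equivalent to g = 0 in every direction. -/

noncomputable section

namespace EddyControl

/-! ### Degree bounds, divisibility, and edge-free planar Nédélec fields -/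

section Polynomials

variable {σ τ : Type*}

/-- `p` has total degree less than `d`; for `d = 0` this means `p = 0`. -/
def DegLT (d : ℕ) (p : MvPolynomial σ ℂ) : Prop := p = 0 ∨ p.totalDegree < d

theorem DegLT.zero (d : ℕ) : DegLT d (0 : MvPolynomial σ ℂ) := Or.inl rfl

theorem degLT_of_totalDegree_le {d : ℕ} {p : MvPolynomial σ ℂ} (h : p.totalDegree ≤ d) :
    DegLT (d + 1) p := Or.inr (Nat.lt_succ_of_le h)

theorem DegLT.totalDegree_le {d : ℕ} {p : MvPolynomial σ ℂ} (h : DegLT (d + 1) p) :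
    p.totalDegree ≤ d := by
  rcases h with rfl | h
  · simp
  · omega

theorem DegLT.add {d : ℕ} {p q : MvPolynomial σ ℂ} (hp : DegLT d p) (hq : DegLT d q) :
    DegLT d (p + q) := by
  rcases hp with rfl | hp
  · simpa using hq
  rcases hq with rfl | hq
  · exact Or.inr (by simpa using hp)
  exact Or.inr ((totalDegree_add p q).trans_lt (max_lt hp hq))

theorem DegLT.neg {d : ℕ} {p : MvPolynomial σ ℂ} (hp : DegLT d p) : DegLT d (-p) := by
  rcases hp with rfl | hp
  · simpa using DegLT.zero d
  · exact Or.inr (by rwa [totalDegree_neg])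

theorem DegLT.sub {d : ℕ} {p q : MvPolynomial σ ℂ} (hp : DegLT d p) (hq : DegLT d q) :
    DegLT d (p - q) := sub_eq_add_neg p q ▸ hp.add hq.neg

theorem DegLT.sum {ι : Type*} {s : Finset ι} {d : ℕ} {p : ι → MvPolynomial σ ℂ}
    (h : ∀ i ∈ s, DegLT d (p i)) : DegLT d (∑ i ∈ s, p i) :=
  Finset.sum_induction p (DegLT d) (fun _ _ => DegLT.add) (DegLT.zero d) h

theorem DegLT.mul {d e : ℕ} {p q : MvPolynomial σ ℂ} (hp : p.totalDegree ≤ e) (hq : DegLT d q) :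
    DegLT (d + e) (p * q) := by
  rcases hq with rfl | hq
  · simpa using DegLT.zero _
  · exact Or.inr ((totalDegree_mul p q).trans_lt (by omega))

/-- Degrees add over a domain, so cancelling a nonconstant factor lowers the bound by at least one.
For `d = 0` this forces `q = 0`, which settles the lowest order k = 0 without a separate case. -/
theorem DegLT.of_mul {d : ℕ} {p q : MvPolynomial σ ℂ} (hp : 1 ≤ p.totalDegree)
    (h : DegLT (d + 1) (p * q)) : DegLT d q := by
  by_cases hq : q = 0
  · exact Or.inl hq
  have hp0 : p ≠ 0 := by rintro rfl; simp at hp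
  rcases h with h | h
  · exact absurd h (mul_ne_zero hp0 hq)
  · rw [totalDegree_mul_of_isDomain hp0 hq] at h
    exact Or.inr (by omega)

theorem totalDegree_aeval_le {g : σ → MvPolynomial τ ℂ} (hg : ∀ i, (g i).totalDegree ≤ 1)
    (p : MvPolynomial σ ℂ) : (aeval g p).totalDegree ≤ p.totalDegree := by
  rw [aeval_def, eval₂_eq]
  refine totalDegree_finsetSum_le fun m hm => ?_
  refine (totalDegree_mul _ _).trans ?_
  rw [algebraMap_eq, totalDegree_C, zero_add]
  refine (totalDegree_finsetProd _ _).trans (le_trans ?_ (le_totalDegree hm))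
  refine Finset.sum_le_sum fun i _ => (totalDegree_pow _ _).trans ?_
  simpa using Nat.mul_le_mul_left (m i) (hg i)

theorem DegLT.aeval {g : σ → MvPolynomial τ ℂ} (hg : ∀ i, (g i).totalDegree ≤ 1) {d : ℕ}
    {p : MvPolynomial σ ℂ} (h : DegLT d p) : DegLT d (MvPolynomial.aeval g p) := by
  rcases h with rfl | h
  · simpa using DegLT.zero d
  · exact Or.inr ((totalDegree_aeval_le hg p).trans_lt h)

/-- Modulo `l` the substitution `g` fixes every variable, hence every polynomial. With `g` a
parametrization of the line `l = 0`, vanishing on the line becomes divisibility by `l`. -/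
theorem dvd_sub_aeval {l : MvPolynomial σ ℂ} {g : σ → MvPolynomial σ ℂ} (hg : ∀ i, l ∣ X i - g i)
    (p : MvPolynomial σ ℂ) : l ∣ p - MvPolynomial.aeval g p := by
  have h : Ideal.Quotient.mkₐ ℂ (Ideal.span {l}) =
      (Ideal.Quotient.mkₐ ℂ (Ideal.span {l})).comp (MvPolynomial.aeval g) := by
    refine algHom_ext fun i => ?_
    simpa [Ideal.Quotient.eq, Ideal.mem_span_singleton] using hg i
  have := DFunLike.congr_fun h p
  simpa [Ideal.Quotient.eq, Ideal.mem_span_singleton] using this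

theorem dvd_of_aeval_eq_zero {l : MvPolynomial σ ℂ} {g : σ → MvPolynomial σ ℂ}
    (hg : ∀ i, l ∣ X i - g i) {p : MvPolynomial σ ℂ} (hp : MvPolynomial.aeval g p = 0) :
    l ∣ p := by
  have h := dvd_sub_aeval hg p
  rwa [hp, sub_zero] at h

/-- The polynomial whose values at real points are the conjugates of those of `p`. -/
def conjPoly (p : MvPolynomial σ ℂ) : MvPolynomial σ ℂ := MvPolynomial.map (starRingEnd ℂ) p

theorem DegLT.conjPoly {d : ℕ} {p : MvPolynomial σ ℂ} (h : DegLT d p) :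
    DegLT d (conjPoly p) := by
  rcases h with rfl | h
  · exact Or.inl (by simp [EddyControl.conjPoly])
  · exact Or.inr (lt_of_le_of_lt (Finset.sup_mono (support_map_subset _ p)) h)

variable {d : ℕ}

/-- A real point, regarded as a complex one. -/
def ofRealPt (s : Fin d → ℝ) : Fin d → ℂ := fun i => (s i : ℂ)

theorem eval_conjPoly (p : MvPolynomial (Fin d) ℂ) (s : Fin d → ℝ) :
    eval (ofRealPt s) (conjPoly p) = conj (eval (ofRealPt s) p) := by
  rw [conjPoly, eval_map, ← coe_eval₂Hom, ← RingHom.comp_apply]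
  refine RingHom.congr_fun (f := _) (g := _) ?_ p
  ext i <;> simp [ofRealPt]

/-- A ball for the sup metric is a product of intervals, and a polynomial vanishing on a product of
infinite sets is zero. -/
theorem eq_zero_of_eval_eq_zero_on_open {U : Set (Fin d → ℝ)} (hU : IsOpen U) (hne : U.Nonempty)
    {p : MvPolynomial (Fin d) ℂ} (h : ∀ s ∈ U, eval (ofRealPt s) p = 0) : p = 0 := by
  obtain ⟨x, hx⟩ := hne
  obtain ⟨ε, hε, hb⟩ := Metric.isOpen_iff.1 hU x hx
  refine funext_set (fun i => ((↑) : ℝ → ℂ) '' Metric.ball (x i) ε) (fun i => ?_) ?_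
  · refine Set.Infinite.image Complex.ofReal_injective.injOn ?_
    rw [Real.ball_eq_Ioo]
    exact Set.Ioo_infinite (by linarith)
  · intro y hy
    choose s hs hsy using fun i => hy i (Set.mem_univ i)
    have : y = ofRealPt s := funext fun i => (hsy i).symm
    rw [this, h s (hb ?_), map_zero]
    rw [ball_pi x hε]
    exact fun i _ => hs i

/-- Structure of the planar Nédélec fields on the reference triangle whose tangential traces on
the three edges vanish. -/
theorem exists_bubble_representation {k : ℕ} {f₁ f₂ : MvPolynomial (Fin 2) ℂ}
    (hx : DegLT (k + 2) (X 0 * f₁ + X 1 * f₂)) (h₁ : DegLT (k + 2) f₁)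
    (e₁ : MvPolynomial.aeval ![X 0, 0] f₁ = (0 : MvPolynomial (Fin 2) ℂ))
    (e₂ : MvPolynomial.aeval ![0, X 1] f₂ = (0 : MvPolynomial (Fin 2) ℂ))
    (e₃ : MvPolynomial.aeval ![X 0, 1 - X 0] (f₂ - f₁) = (0 : MvPolynomial (Fin 2) ℂ)) :
    ∃ m n : MvPolynomial (Fin 2) ℂ, DegLT k m ∧ DegLT k n ∧
      f₁ = X 1 * (X 0 * (m + n) + (1 - X 0 - X 1) * m) ∧
      f₂ = X 0 * (X 1 * (m + n) + (1 - X 0 - X 1) * n) := by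
  have hl : 1 ≤ (1 - X 0 - X 1 : MvPolynomial (Fin 2) ℂ).totalDegree := by
    by_contra hlt
    obtain ⟨c, hc⟩ : ∃ c, (1 - X 0 - X 1 : MvPolynomial (Fin 2) ℂ) = C c :=
      ⟨_, totalDegree_eq_zero_iff_eq_C.1 (by omega)⟩
    have h0 := congrArg (eval (fun _ => (0 : ℂ))) hc
    have h1 := congrArg (eval (fun _ => (1 : ℂ))) hc
    simp at h0 h1
    rw [← h0] at h1
    norm_num at h1
  obtain ⟨g₁, rfl⟩ : X 1 ∣ f₁ := dvd_of_aeval_eq_zero (fun i => by fin_cases i <;> simp) e₁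
  obtain ⟨g₂, rfl⟩ : X 0 ∣ f₂ := dvd_of_aeval_eq_zero (fun i => by fin_cases i <;> simp) e₂
  have hg₁ : DegLT (k + 1) g₁ := DegLT.of_mul (by simp) h₁
  -- Here the Nédélec condition enters: X₀f₁ + X₁f₂ = X₀X₁(g₁ + g₂) has degree below k + 2 instead
  -- of k + 3.
  have hh : DegLT k (g₁ + g₂) := by
    refine DegLT.of_mul (p := X 0) (by simp) (DegLT.of_mul (p := X 1) (by simp) ?_)
    convert hx using 1
    ring
  -- On the third edge X₁ = 1 - X₀, so f₂ - f₁ = X₀(g₁ + g₂) - g₁ there.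
  obtain ⟨m, hm⟩ : (1 - X 0 - X 1) ∣ g₁ - X 0 * (g₁ + g₂) := by
    refine dvd_of_aeval_eq_zero (g := ![X 0, 1 - X 0]) (fun i => ?_) ?_
    · fin_cases i
      · simp
      · exact ⟨-1, by simp⟩
    · simp only [map_sub, map_mul, map_add, aeval_X, Matrix.cons_val_zero, Matrix.cons_val_one] at e₃ ⊢
      linear_combination -e₃
  have hmd : DegLT k m := by
    refine DegLT.of_mul hl ?_
    rw [← hm]
    exact hg₁.sub (hh.mul (by simp))
  refine ⟨m, g₁ + g₂ - m, hmd, hh.sub hmd, ?_, ?_⟩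
  · linear_combination X 1 * hm
  · linear_combination -X 0 * hm

end Polynomials

/-! ### Affine parametrization of simplices and Hausdorff measure on them -/

section Simplex

variable {d : ℕ}

/-- The affine map with linear part spanned by the edges `v l.succ - v 0`. -/
def edgeMap (v : Fin (d + 1) → E3) : (Fin d → ℝ) →ₗ[ℝ] E3 :=
  Fintype.linearCombination ℝ fun l : Fin d => v l.succ - v 0

/-- The affine parametrization of the plane through the points `v i`. -/
def affPt (v : Fin (d + 1) → E3) (s : Fin d → ℝ) : E3 := v 0 + edgeMap v s

theorem affPt_eq (v : Fin (d + 1) → E3) (s : Fin d → ℝ) :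
    affPt v s = v 0 + ∑ l, s l • (v l.succ - v 0) := by
  simp [affPt, edgeMap, Fintype.linearCombination_apply]

theorem continuous_affPt (v : Fin (d + 1) → E3) : Continuous (affPt v) :=
  continuous_const.add (LinearMap.continuous_of_finiteDimensional _)

/-- The reference simplex. -/
def refSimplex (d : ℕ) : Set (Fin d → ℝ) := {s | (∀ l, 0 ≤ s l) ∧ ∑ l, s l ≤ 1}

theorem convexHull_range_eq_image (v : Fin (d + 1) → E3) :
    convexHull ℝ (Set.range v) = affPt v '' refSimplex d := by
  apply Set.Subset.antisymm
  · refine convexHull_min ?_ ?_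
    · rintro _ ⟨i, rfl⟩
      refine Fin.cases ?_ (fun l => ?_) i
      · exact ⟨0, by simp [refSimplex], by simp [affPt]⟩
      · refine ⟨Pi.single l 1, ⟨fun m => ?_, by simp⟩, ?_⟩
        · by_cases h : m = l
          · subst h; simp
          · simp [h]
        · simp [affPt, edgeMap, Fintype.linearCombination_apply_single]
    · rintro _ ⟨s, ⟨hs, hs'⟩, rfl⟩ _ ⟨t, ⟨ht, ht'⟩, rfl⟩ a b ha hb hab
      refine ⟨a • s + b • t, ⟨fun l => ?_, ?_⟩, ?_⟩
      · simpa using add_nonneg (mul_nonneg ha (hs l)) (mul_nonneg hb (ht l))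
      · simp only [Pi.add_apply, Pi.smul_apply, smul_eq_mul, Finset.sum_add_distrib,
          ← Finset.mul_sum]
        nlinarith
      · simp only [affPt, map_add, map_smul, smul_add]
        rw [add_add_add_comm, ← add_smul, hab, one_smul]
  · rintro _ ⟨s, ⟨hs, hs'⟩, rfl⟩
    have h : affPt v s = ∑ i : Fin (d + 1), (Fin.cons (1 - ∑ l, s l) s : Fin (d + 1) → ℝ) i • v i := by
      rw [affPt_eq, Fin.sum_univ_succ]
      simp only [Fin.cons_zero, Fin.cons_succ, smul_sub, Finset.sum_sub_distrib, sub_smul, one_smul,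
        Finset.sum_smul]
      abel
    rw [h]
    refine (convex_convexHull ℝ _).sum_mem (fun i _ => ?_) ?_
      (fun i _ => subset_convexHull ℝ _ ⟨i, rfl⟩)
    · refine Fin.cases ?_ (fun l => ?_) i
      · simpa using hs'
      · simpa using hs l
    · simp [Fin.sum_univ_succ]

theorem isCompact_refSimplex (d : ℕ) : IsCompact (refSimplex d) := by
  refine Metric.isCompact_of_isClosed_isBounded ?_ ?_
  · have h1 : IsClosed {s : Fin d → ℝ | ∀ l, 0 ≤ s l} := by
      simp only [Set.ofPred_forall]
      exact isClosed_iInter fun l => isClosed_le continuous_const (continuous_apply l)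
    exact h1.inter (isClosed_le (continuous_finsetSum _ fun l _ => continuous_apply l) continuous_const)
  · refine (Metric.isBounded_Icc (0 : Fin d → ℝ) 1).subset fun s hs => ⟨hs.1, fun l => ?_⟩
    exact (Finset.single_le_sum (fun i _ => hs.1 i) (Finset.mem_univ l)).trans hs.2

/-- Only finiteness and null sets matter below, so the normalizing factor may stay unspecified as
long as it is nonzero. -/
theorem euclideanHausdorffMeasure_apply (d : ℕ) :
    ∃ c : NNReal, c ≠ 0 ∧ ∀ A : Set E3, (μHE[d] : Measure E3) A = c * Measure.hausdorffMeasure d A := by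
  refine ⟨_, Measure.addHaarScalarFactor_volume_hausdorffMeasure_ne_zero d, fun A => ?_⟩
  rw [Measure.euclideanHausdorffMeasure_def]
  rfl

theorem hausdorff_fin_real (d : ℕ) :
    (Measure.hausdorffMeasure (d : ℝ) : Measure (Fin d → ℝ)) = volume := by
  simpa using hausdorffMeasure_pi_real (ι := Fin d)

/-- The hull is the Lipschitz image of a compact set in ℝᵈ, even when the simplex degenerates. -/
theorem measure_convexHull_range_lt_top (v : Fin (d + 1) → E3) :
    (μHE[d] : Measure E3) (convexHull ℝ (Set.range v)) < ⊤ := by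
  obtain ⟨c, -, hc⟩ := euclideanHausdorffMeasure_apply d
  rw [hc, convexHull_range_eq_image]
  obtain ⟨K, hK⟩ : ∃ K, LipschitzWith K (affPt v) := by
    refine ⟨‖(edgeMap v).toContinuousLinearMap‖₊, fun x y => ?_⟩
    have := (edgeMap v).toContinuousLinearMap.lipschitz x y
    simpa [affPt] using this
  refine ENNReal.mul_lt_top (by simp) ((hK.hausdorffMeasure_image_le (by positivity) _).trans_lt ?_)
  rw [hausdorff_fin_real]
  exact ENNReal.mul_lt_top (by simp) (isCompact_refSimplex d).measure_lt_top

theorem integrableOn_convexHull_range {G : Type*} [NormedAddCommGroup G]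
    (v : Fin (d + 1) → E3) {f : E3 → G} (hf : Continuous f) :
    IntegrableOn f (convexHull ℝ (Set.range v)) (μHE[d] : Measure E3) := by
  have hK : IsCompact (convexHull ℝ (Set.range v)) := by
    rw [convexHull_range_eq_image]
    exact (isCompact_refSimplex d).image (continuous_affPt v)
  exact hf.continuousOn.integrableOn_of_subset_isCompact hK hK.measurableSet subset_rfl
    (measure_convexHull_range_lt_top v).ne

/-- This takes the place of a change of variables. The integrand vanishes almost everywhere on the
simplex; the injective edge map is antilipschitz, so the exceptional set pulls back to a Lebesgue
null set; an open null set is empty. -/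
theorem eq_zero_of_setIntegral_eq_zero {v : Fin (d + 1) → E3}
    (hv : LinearIndependent ℝ fun l : Fin d => v l.succ - v 0) {g : E3 → ℝ} (hg : Continuous g)
    (h0 : ∀ s ∈ refSimplex d, 0 ≤ g (affPt v s))
    (hint : ∫ x in convexHull ℝ (Set.range v), g x ∂(μHE[d] : Measure E3) = 0)
    {U : Set (Fin d → ℝ)} (hU : IsOpen U) (hUs : U ⊆ refSimplex d) :
    ∀ s ∈ U, g (affPt v s) = 0 := by
  set H := convexHull ℝ (Set.range v) with hH
  have hHm : MeasurableSet H := by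
    rw [hH, convexHull_range_eq_image]
    exact ((isCompact_refSimplex d).image (continuous_affPt v)).measurableSet
  have h1 : ∀ᵐ x ∂(μHE[d] : Measure E3).restrict H, g x = 0 := by
    refine (integral_eq_zero_iff_of_nonneg_ae ?_ (integrableOn_convexHull_range v hg)).1 hint
    rw [Filter.EventuallyLE, ae_restrict_iff' hHm]
    refine Filter.Eventually.of_forall fun x hx => ?_
    rw [hH, convexHull_range_eq_image] at hx
    obtain ⟨s, hs, rfl⟩ := hx
    exact h0 s hs
  rw [ae_restrict_iff' hHm, ae_iff] at h1
  obtain ⟨c, hc0, hc⟩ := euclideanHausdorffMeasure_apply d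
  rw [hc, mul_eq_zero] at h1
  have h2 := h1.resolve_left (by exact_mod_cast hc0)
  have hker : LinearMap.ker (edgeMap v) = ⊥ := by
    rw [LinearMap.ker_eq_bot, edgeMap]
    exact linearIndependent_iff_injective_fintypeLinearCombination.1 hv
  obtain ⟨K, -, hK⟩ := (edgeMap v).exists_antilipschitzWith hker
  have hK' : AntilipschitzWith K (affPt v) := fun x y => by simpa [affPt] using hK x y
  have h3 := hK'.hausdorffMeasure_preimage_le (d := d) (by positivity)
    {a | ¬(a ∈ H → g a = 0)}
  rw [h2, mul_zero, hausdorff_fin_real, nonpos_iff_eq_zero] at h3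
  have hopen : IsOpen (U ∩ {s | g (affPt v s) ≠ 0}) :=
    hU.inter (isOpen_ne_fun (hg.comp (continuous_affPt v)) continuous_const)
  have h4 : volume (U ∩ {s | g (affPt v s) ≠ 0}) = 0 := by
    refine measure_mono_null ?_ h3
    rintro s ⟨hs, hs'⟩ hcon
    exact hs' (hcon (by rw [hH, convexHull_range_eq_image]; exact ⟨s, hUs hs, rfl⟩))
  intro s hs
  by_contra hne
  have := hopen.measure_eq_zero_iff volume |>.1 h4
  exact (this ▸ (⟨hs, hne⟩ : s ∈ U ∩ {s | g (affPt v s) ≠ 0}) : s ∈ (∅ : Set _))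

/-- The interior of the reference simplex. -/
def openSimplex (d : ℕ) : Set (Fin d → ℝ) := {s | (∀ l, 0 < s l) ∧ ∑ l, s l < 1}

theorem isOpen_openSimplex (d : ℕ) : IsOpen (openSimplex d) := by
  have h1 : IsOpen {s : Fin d → ℝ | ∀ l, 0 < s l} := by
    simp only [Set.ofPred_forall]
    exact isOpen_iInter_of_finite fun l => isOpen_lt continuous_const (continuous_apply l)
  exact h1.inter (isOpen_lt (continuous_finsetSum _ fun l _ => continuous_apply l) continuous_const)

theorem openSimplex_subset (d : ℕ) : openSimplex d ⊆ refSimplex d :=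
  fun _ hs => ⟨fun l => (hs.1 l).le, hs.2.le⟩

theorem openSimplex_nonempty (d : ℕ) : (openSimplex d).Nonempty := by
  refine ⟨fun _ => 1 / (d + 1 : ℝ), fun _ => by positivity, ?_⟩
  simp only [Finset.sum_const, Finset.card_univ, Fintype.card_fin, nsmul_eq_mul]
  rw [mul_one_div, div_lt_one (by positivity)]
  linarith

/-- Restriction of a polynomial on `ℝ³` along the parametrization `affPt v`. -/
def affRestrict (v : Fin (d + 1) → E3) : MvPolynomial (Fin 3) ℂ →ₐ[ℂ] MvPolynomial (Fin d) ℂ :=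
  aeval fun i => C ((v 0 i : ℝ) : ℂ) + ∑ l : Fin d, X l * C (((v l.succ - v 0) i : ℝ) : ℂ)

theorem eval_aeval_eq {σ τ : Type*} (x : τ → ℂ) (g : σ → MvPolynomial τ ℂ) (p : MvPolynomial σ ℂ) :
    eval x (aeval g p) = eval (fun i => eval x (g i)) p := by
  rw [← coe_aeval_eq_eval, ← coe_aeval_eq_eval]
  exact DFunLike.congr_fun (comp_aeval (R := ℂ) g (aeval x : MvPolynomial τ ℂ →ₐ[ℂ] ℂ)) p

theorem eval_affRestrict (v : Fin (d + 1) → E3) (p : MvPolynomial (Fin 3) ℂ) (s : Fin d → ℝ) :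
    eval (ofRealPt s) (affRestrict v p) = peval p (affPt v s) := by
  rw [affRestrict, eval_aeval_eq, peval]
  congr 2
  funext i
  simp [toC, affPt_eq, ofRealPt, PiLp.add_apply]

theorem DegLT.affRestrict (v : Fin (d + 1) → E3) {e : ℕ} {p : MvPolynomial (Fin 3) ℂ}
    (h : DegLT e p) : DegLT e (affRestrict v p) := by
  refine h.aeval fun i => ?_
  refine (totalDegree_add _ _).trans (max_le (by simp) ?_)
  refine totalDegree_finsetSum_le fun l _ => (totalDegree_mul _ _).trans ?_
  rw [totalDegree_C, totalDegree_X]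

/-- Barycentric coordinates, as polynomials on `ℝ³`, extend polynomials from the plane. -/
theorem exists_affExtend {v : Fin (d + 1) → E3}
    (hv : LinearIndependent ℝ fun l : Fin d => v l.succ - v 0) {e : ℕ}
    {r : MvPolynomial (Fin d) ℂ} (hr : DegLT e r) :
    ∃ q : MvPolynomial (Fin 3) ℂ, DegLT e q ∧
      ∀ s, peval q (affPt v s) = eval (ofRealPt s) r := by
  have hker : LinearMap.ker (edgeMap v) = ⊥ := by
    rw [LinearMap.ker_eq_bot, edgeMap]
    exact linearIndependent_iff_injective_fintypeLinearCombination.1 hv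
  -- A linear left inverse recovers the parameters from a point of the plane; its matrix `c` gives
  -- polynomials of degree at most one on ℝ³ to substitute into `r`.
  obtain ⟨g, hg⟩ := (edgeMap v).exists_leftInverse_of_injective hker
  let c : Fin d → Fin 3 → ℝ := fun l i => g (EuclideanSpace.single i 1) l
  have hgc : ∀ x l, g x l = ∑ i, c l i * x i := by
    intro x l
    have hx : x = ∑ i, x i • EuclideanSpace.single i (1 : ℝ) := by
      ext m
      simp [Finset.sum_apply, Pi.single_apply]
    conv_lhs => rw [hx]
    simp [c, mul_comm]
  refine ⟨aeval (fun l => ∑ i, C ((c l i : ℝ) : ℂ) * (X i - C ((v 0 i : ℝ) : ℂ))) r,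
    hr.aeval fun l => ?_, fun s => ?_⟩
  · refine totalDegree_finsetSum_le fun i _ => (totalDegree_mul _ _).trans ?_
    rw [totalDegree_C, zero_add]
    exact (totalDegree_sub _ _).trans (by simp)
  · rw [peval, eval_aeval_eq]
    congr 2
    funext l
    have h1 : g (edgeMap v s) l = s l := by
      have := DFunLike.congr_fun hg s
      simpa using congrFun this l
    rw [hgc] at h1
    simp only [ofRealPt]
    rw [← h1]
    simp [toC, affPt]

end Simplex

/-! ### Unisolvence of the boundary moments on one face -/

section Unisolvence

variable {d : ℕ}

/-- A moment integrand is complex-valued on ℝ³ and becomes real only on the plane of the simplex,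
hence the passage to real parts. -/
theorem eq_zero_of_setIntegral_complex_eq_zero {v : Fin (d + 1) → E3}
    (hv : LinearIndependent ℝ fun l : Fin d => v l.succ - v 0) {G : E3 → ℂ} (hG : Continuous G)
    {w : (Fin d → ℝ) → ℝ} (hw : ∀ s, G (affPt v s) = (w s : ℂ))
    (h0 : ∀ s ∈ refSimplex d, 0 ≤ w s)
    (hint : ∫ x in convexHull ℝ (Set.range v), G x ∂(μHE[d] : Measure E3) = 0) :
    ∀ s ∈ openSimplex d, w s = 0 := by
  have h := eq_zero_of_setIntegral_eq_zero hv (g := fun x => RCLike.re (G x))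
    (RCLike.continuous_re.comp hG)
    (fun s hs => by simpa [hw] using h0 s hs)
    (by rw [integral_re (integrableOn_convexHull_range v hG), hint]; simp)
    (isOpen_openSimplex d) (openSimplex_subset d)
  intro s hs
  simpa [hw] using h s hs

theorem continuous_toC : Continuous toC :=
  continuous_pi fun i => Complex.continuous_ofReal.comp
    (PiLp.continuous_apply 2 (fun _ : Fin 3 => ℝ) i)

theorem continuous_peval (p : MvPolynomial (Fin 3) ℂ) : Continuous (peval p) :=
  (MvPolynomial.continuous_eval p).comp continuous_toC

/-- The component of a polynomial field in a fixed direction. -/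
def dirComp (w : E3) (u : PolyField) : MvPolynomial (Fin 3) ℂ := ∑ i, u i * C ((w i : ℝ) : ℂ)

theorem peval_dirComp (w : E3) (u : PolyField) (x : E3) :
    peval (dirComp w u) x = feval u x ⬝ᵥ toC w := by
  simp [peval, dirComp, feval, dotProduct, toC]

/-- Multiplying by x would in general raise the degree from k + 1 to k + 2; the top part contributes
nothing because x · q = 0. Later degree arguments use only these two bounds. -/
theorem degLT_of_mem_localNedelec {k : ℕ} {u : PolyField} (hu : u ∈ localNedelec k) :
    (∀ i, DegLT (k + 2) (u i)) ∧ DegLT (k + 2) (∑ i, X i * u i) := by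
  obtain ⟨p, hp, q, ⟨hq, hq'⟩, rfl⟩ := Submodule.mem_sup.1 hu
  have hp' : ∀ i, (p i).totalDegree ≤ k := fun i =>
    (mem_restrictTotalDegree _ _ _).1 (hp i (Set.mem_univ i))
  have hqd : ∀ i, (q i).totalDegree ≤ k + 1 := fun i =>
    ((mem_homogeneousSubmodule _ _).1 (hq i (Set.mem_univ i))).totalDegree_le
  have hq0 : ∑ i, X i * q i = 0 := by
    simpa [LinearMap.sum_apply] using hq'
  constructor
  · exact fun i => (degLT_of_totalDegree_le ((hp' i).trans (Nat.le_succ k))).add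
      (degLT_of_totalDegree_le (hqd i))
  · simp only [Pi.add_apply, mul_add, Finset.sum_add_distrib, hq0, add_zero]
    exact DegLT.sum fun i _ => (degLT_of_totalDegree_le (hp' i)).mul (e := 1) (by simp)

/-- The tangential components of `u` along the parametrization `affPt v`. -/
def tanComp (v : Fin (d + 1) → E3) (u : PolyField) (l : Fin d) : MvPolynomial (Fin d) ℂ :=
  affRestrict v (dirComp (v l.succ - v 0) u)

theorem eval_tanComp (v : Fin (d + 1) → E3) (u : PolyField) (l : Fin d) (s : Fin d → ℝ) :
    eval (ofRealPt s) (tanComp v u l) = feval u (affPt v s) ⬝ᵥ toC (v l.succ - v 0) := by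
  rw [tanComp, eval_affRestrict, peval_dirComp]

theorem degLT_tanComp (v : Fin (d + 1) → E3) {k : ℕ} {u : PolyField} (hu : u ∈ localNedelec k)
    (l : Fin d) : DegLT (k + 2) (tanComp v u l) := by
  refine DegLT.affRestrict v (DegLT.sum fun i _ => ?_)
  rw [mul_comm]
  exact ((degLT_of_mem_localNedelec hu).1 i).mul (e := 0) (totalDegree_C _).le

/-- The sum is the restriction of (x - v₀) · u, and v₀ · u has degree at most k + 1 anyway. So the
Nédélec condition survives restriction to an affine plane or line with a shifted origin. -/
theorem degLT_sum_mul_tanComp (v : Fin (d + 1) → E3) {k : ℕ} {u : PolyField}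
    (hu : u ∈ localNedelec k) : DegLT (k + 2) (∑ l, X l * tanComp v u l) := by
  obtain ⟨h1, h2⟩ := degLT_of_mem_localNedelec hu
  have h : ∑ l, X l * tanComp v u l =
      affRestrict v (∑ i, X i * u i - ∑ i, C ((v 0 i : ℝ) : ℂ) * u i) := by
    rw [← Finset.sum_sub_distrib, map_sum]
    simp only [tanComp, dirComp, map_sum, Finset.mul_sum]
    rw [Finset.sum_comm]
    refine Finset.sum_congr rfl fun i _ => ?_
    rw [← sub_mul, map_mul, map_sub]
    have hX : affRestrict v (X i) = C ((v 0 i : ℝ) : ℂ) +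
        ∑ l : Fin d, X l * C (((v l.succ - v 0) i : ℝ) : ℂ) := by simp [affRestrict]
    have hC : ∀ c : ℂ, affRestrict v (C c) = C c := fun c => by simp [affRestrict]
    rw [hX, hC, add_sub_cancel_left, Finset.sum_mul]
    refine Finset.sum_congr rfl fun l _ => ?_
    rw [map_mul, hC]
    ring
  rw [h]
  exact (h2.sub (DegLT.sum fun i _ => (h1 i).mul (e := 0) (by simp))).affRestrict v

theorem segment_eq_convexHull_range (a b : E3) :
    segment ℝ a b = convexHull ℝ (Set.range ![a, b]) := by
  rw [Matrix.range_cons, Matrix.range_cons, Matrix.range_empty, Set.union_empty,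
    ← convexHull_pair, Set.singleton_union]

theorem affPt_pair (a b : E3) (s : Fin 1 → ℝ) : affPt ![a, b] s = a + s 0 • (b - a) := by
  simp [affPt_eq]

theorem tangential_eq_zero_on_edge {k : ℕ} {u : PolyField} (hu : u ∈ localNedelec k) {a b : E3}
    (hab : a ≠ b)
    (hm : ∀ q : MvPolynomial (Fin 3) ℂ, q.totalDegree ≤ k →
      Triangulation.edgeMoment u a b q = 0) (r : ℝ) :
    feval u (a + r • (b - a)) ⬝ᵥ toC (b - a) = 0 := by
  have hv : LinearIndependent ℝ fun l : Fin 1 => (![a, b] : Fin 2 → E3) l.succ - ![a, b] 0 := by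
    rw [linearIndependent_unique_iff]
    simpa [sub_eq_zero] using hab.symm
  set F := tanComp ![a, b] u 0 with hF
  -- In one variable the Nédélec condition bounds `X 0 * F`, so `F` has degree at most k although
  -- `u` may have degree k + 1; its conjugate is therefore an admissible test polynomial.
  have hFd : DegLT (k + 1) F := by
    refine DegLT.of_mul (p := X 0) (by simp) ?_
    simpa using degLT_sum_mul_tanComp ![a, b] hu
  obtain ⟨q, hq, hqe⟩ := exists_affExtend hv hFd.conjPoly
  have h0 : ∀ s ∈ openSimplex 1, ‖eval (ofRealPt s) F‖ ^ 2 = 0 := by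
    refine eq_zero_of_setIntegral_complex_eq_zero hv
      (G := fun x => (feval u x ⬝ᵥ toC (b - a)) * peval q x) ?_ (fun s => ?_)
      (fun s _ => by positivity) ?_
    · simp only [← peval_dirComp]
      exact (continuous_peval _).mul (continuous_peval _)
    · rw [hqe, eval_conjPoly]
      have : feval u (affPt ![a, b] s) ⬝ᵥ toC (b - a) = eval (ofRealPt s) F := by
        rw [hF, eval_tanComp]; simp
      rw [this, Complex.mul_conj, Complex.normSq_eq_norm_sq]
    · have := hm q hq.totalDegree_le
      rw [Triangulation.edgeMoment, segment_eq_convexHull_range] at this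
      exact this
  have hF0 : F = 0 := eq_zero_of_eval_eq_zero_on_open (isOpen_openSimplex 1)
    (openSimplex_nonempty 1) fun s hs => by simpa using h0 s hs
  have := eval_tanComp ![a, b] u 0 (fun _ => r)
  rw [← hF, hF0, map_zero, affPt_pair] at this
  simpa using this.symm

theorem toC_sub (a b : E3) : toC (a - b) = toC a - toC b := by
  funext i; simp [toC]

theorem tangential_eq_zero_on_triangle {k : ℕ} {u : PolyField} (hu : u ∈ localNedelec k)
    {v : Fin 3 → E3} (hv : LinearIndependent ℝ fun l : Fin 2 => v l.succ - v 0)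
    (he : ∀ i j, i ≠ j → ∀ r : ℝ, feval u (v i + r • (v j - v i)) ⬝ᵥ toC (v j - v i) = 0)
    (hm : ∀ l : Fin 2, ∀ q : MvPolynomial (Fin 3) ℂ, q.totalDegree < k →
      ∫ x in convexHull ℝ (Set.range v), (feval u x ⬝ᵥ toC (v l.succ - v 0)) * peval q x
        ∂(μHE[2] : Measure E3) = 0) (l : Fin 2) (s : Fin 2 → ℝ) :
    feval u (affPt v s) ⬝ᵥ toC (v l.succ - v 0) = 0 := by
  have haff : ∀ s : Fin 2 → ℝ, affPt v s = v 0 + (s 0 • (v 1 - v 0) + s 1 • (v 2 - v 0)) :=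
    fun s => by simp [affPt_eq, Fin.sum_univ_two]
  have hsub : ∀ (g : Fin 2 → MvPolynomial (Fin 2) ℂ) (p : MvPolynomial (Fin 2) ℂ),
      (∀ s, eval (fun i => eval (ofRealPt s) (g i)) p = 0) → aeval g p = 0 := fun g p h =>
    eq_zero_of_eval_eq_zero_on_open isOpen_univ Set.univ_nonempty fun s _ => by
      rw [eval_aeval_eq]; exact h s
  have hpt : ∀ (g : Fin 2 → MvPolynomial (Fin 2) ℂ) (s t : Fin 2 → ℝ),
      eval (ofRealPt s) (g 0) = t 0 → eval (ofRealPt s) (g 1) = t 1 →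
      (fun i => eval (ofRealPt s) (g i)) = ofRealPt t := fun g s t h0 h1 => by
    funext i
    fin_cases i
    · exact h0
    · exact h1
  have hsum : DegLT (k + 2) (X 0 * tanComp v u 0 + X 1 * tanComp v u 1) := by
    simpa [Fin.sum_univ_two] using degLT_sum_mul_tanComp v hu
  obtain ⟨m, n, hmd, hnd, hf₁, hf₂⟩ := exists_bubble_representation hsum (degLT_tanComp v hu 0)
    (hsub _ _ fun s => by
      rw [hpt ![X 0, 0] s ![s 0, 0] (by simp [ofRealPt]) (by simp), eval_tanComp, haff]
      simpa using he 0 1 (by decide) (s 0))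
    (hsub _ _ fun s => by
      rw [hpt ![0, X 1] s ![0, s 1] (by simp) (by simp [ofRealPt]), eval_tanComp, haff]
      simpa using he 0 2 (by decide) (s 1))
    (hsub _ _ fun s => by
      rw [hpt ![X 0, 1 - X 0] s ![s 0, 1 - s 0] (by simp [ofRealPt]) (by simp [ofRealPt]),
        map_sub, eval_tanComp, eval_tanComp, haff, ← dotProduct_sub, ← toC_sub]
      have h1 : v 0 + ((![s 0, 1 - s 0] : Fin 2 → ℝ) 0 • (v 1 - v 0) +
          (![s 0, 1 - s 0] : Fin 2 → ℝ) 1 • (v 2 - v 0)) = v 1 + (1 - s 0) • (v 2 - v 1) := by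
        simp only [Matrix.cons_val_zero, Matrix.cons_val_one]
        module
      have h2 : v (1 : Fin 2).succ - v 0 - (v (0 : Fin 2).succ - v 0) = v 2 - v 1 := by
        simp
      rw [h1, h2]
      exact he 1 2 (by decide) (1 - s 0))
  obtain ⟨q₁, hq₁, hq₁e⟩ := exists_affExtend hv hmd.conjPoly
  obtain ⟨q₂, hq₂, hq₂e⟩ := exists_affExtend hv hnd.conjPoly
  -- For k = 0 the condition `q.totalDegree < k` excludes even the zero polynomial, whose moment
  -- vanishes trivially.
  have hm' : ∀ l : Fin 2, ∀ q : MvPolynomial (Fin 3) ℂ, DegLT k q →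
      ∫ x in convexHull ℝ (Set.range v), (feval u x ⬝ᵥ toC (v l.succ - v 0)) * peval q x
        ∂(μHE[2] : Measure E3) = 0 := by
    rintro l q (rfl | hq)
    · simp [peval]
    · exact hm l q hq
  have hcont : ∀ (l : Fin 2) (q : MvPolynomial (Fin 3) ℂ),
      Continuous fun x => (feval u x ⬝ᵥ toC (v l.succ - v 0)) * peval q x := fun l q => by
    simp only [← peval_dirComp]
    exact (continuous_peval _).mul (continuous_peval _)
  -- On the plane `q₁` and `q₂` are conj m and conj n. In f₁ conj m + f₂ conj n the mixed terms
  -- combine to s₀s₁|m + n|², leaving the nonnegative weight `w`.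
  have h0 := eq_zero_of_setIntegral_complex_eq_zero hv
    (G := fun x => (feval u x ⬝ᵥ toC (v (0 : Fin 2).succ - v 0)) * peval q₁ x +
      (feval u x ⬝ᵥ toC (v (1 : Fin 2).succ - v 0)) * peval q₂ x)
    (w := fun s => s 0 * s 1 * ‖eval (ofRealPt s) (m + n)‖ ^ 2 +
      s 1 * (1 - s 0 - s 1) * ‖eval (ofRealPt s) m‖ ^ 2 +
      s 0 * (1 - s 0 - s 1) * ‖eval (ofRealPt s) n‖ ^ 2)
    ((hcont 0 q₁).add (hcont 1 q₂))
    (fun s => by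
      rw [hq₁e, hq₂e, eval_conjPoly, eval_conjPoly, ← eval_tanComp, ← eval_tanComp, hf₁, hf₂]
      push_cast
      simp only [← Complex.mul_conj']
      simp only [map_mul, map_add, map_sub, map_one, eval_X, ofRealPt]
      ring)
    (fun s hs => by
      have h3 : 0 ≤ 1 - s 0 - s 1 := by
        have := hs.2
        rw [Fin.sum_univ_two] at this
        linarith
      have h1 := hs.1 0
      have h2 := hs.1 1
      positivity)
    (by
      rw [integral_add (integrableOn_convexHull_range v (hcont 0 q₁))
        (integrableOn_convexHull_range v (hcont 1 q₂)), hm' 0 q₁ hq₁, hm' 1 q₂ hq₂, add_zero])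
  have hpos : ∀ s ∈ openSimplex 2, eval (ofRealPt s) m = 0 ∧ eval (ofRealPt s) n = 0 := by
    intro s hs
    have h3 : 0 < 1 - s 0 - s 1 := by
      have := hs.2
      rw [Fin.sum_univ_two] at this
      linarith
    have h1 := hs.1 0
    have h2 := hs.1 1
    have hA : 0 ≤ s 0 * s 1 * ‖eval (ofRealPt s) (m + n)‖ ^ 2 := by positivity
    have hB : 0 ≤ s 1 * (1 - s 0 - s 1) * ‖eval (ofRealPt s) m‖ ^ 2 := by positivity
    have hC : 0 ≤ s 0 * (1 - s 0 - s 1) * ‖eval (ofRealPt s) n‖ ^ 2 := by positivity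
    have hs0 := h0 s hs
    have hB0 : s 1 * (1 - s 0 - s 1) * ‖eval (ofRealPt s) m‖ ^ 2 = 0 := by linarith
    have hC0 : s 0 * (1 - s 0 - s 1) * ‖eval (ofRealPt s) n‖ ^ 2 = 0 := by linarith
    constructor
    · simpa [h2.ne', h3.ne'] using hB0
    · simpa [h1.ne', h3.ne'] using hC0
  have hm0 : m = 0 := eq_zero_of_eval_eq_zero_on_open (isOpen_openSimplex 2)
    (openSimplex_nonempty 2) fun s hs => (hpos s hs).1
  have hn0 : n = 0 := eq_zero_of_eval_eq_zero_on_open (isOpen_openSimplex 2)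
    (openSimplex_nonempty 2) fun s hs => (hpos s hs).2
  rw [← eval_tanComp]
  fin_cases l
  · change eval _ (tanComp v u 0) = 0
    rw [hf₁, hm0, hn0]; simp
  · change eval _ (tanComp v u 1) = 0
    rw [hf₂, hm0, hn0]; simp

/-- A triple of distinct points enumerating a face, with independent edges. -/
theorem exists_enumeration {F : Finset E3} (hc : F.card = 3)
    (hF : AffineIndependent ℝ ((↑) : F → E3)) :
    ∃ v : Fin 3 → E3, Function.Injective v ∧ Set.range v = F ∧
      LinearIndependent ℝ fun l : Fin 2 => v l.succ - v 0 := by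
  let e : Fin 3 ≃ F := (finCongr hc.symm).trans F.equivFin.symm
  refine ⟨fun i => e i, Subtype.val_injective.comp e.injective, ?_, ?_⟩
  · ext x
    constructor
    · rintro ⟨i, rfl⟩
      exact (e i).2
    · intro hx
      exact ⟨e.symm ⟨x, hx⟩, by simp⟩
  · have h := hF.comp_embedding e.toEmbedding
    rw [affineIndependent_iff_linearIndependent_vsub ℝ _ (0 : Fin 3)] at h
    exact h.comp (fun l : Fin 2 => (⟨l.succ, Fin.succ_ne_zero l⟩ : {x : Fin 3 // x ≠ 0}))
      fun a b hab => Fin.succ_injective _ (congrArg Subtype.val hab)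

theorem tangential_eq_zero_of_moments_eq_zero {k : ℕ} {u : PolyField} (hu : u ∈ localNedelec k)
    {F : Finset E3} (hc : F.card = 3) (hF : AffineIndependent ℝ ((↑) : F → E3))
    (he : ∀ a ∈ F, ∀ b ∈ F, ∀ q : MvPolynomial (Fin 3) ℂ, q.totalDegree ≤ k →
      Triangulation.edgeMoment u a b q = 0)
    (hm : ∀ a ∈ F, ∀ b ∈ F, ∀ q : MvPolynomial (Fin 3) ℂ, q.totalDegree < k →
      Triangulation.faceMoment u F a b q = 0) :
    ∀ x ∈ Triangulation.hull F, ∀ a ∈ F, ∀ b ∈ F, feval u x ⬝ᵥ toC (b - a) = 0 := by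
  obtain ⟨v, hvi, hvr, hv⟩ := exists_enumeration hc hF
  have hvF : ∀ i, v i ∈ F := fun i => by
    have : v i ∈ Set.range v := ⟨i, rfl⟩
    rw [hvr] at this
    exact this
  have key := tangential_eq_zero_on_triangle hu hv
    (fun i j hij r => tangential_eq_zero_on_edge hu (hvi.ne hij) (he _ (hvF i) _ (hvF j)) r)
    (fun l q hq => by
      rw [hvr]
      exact hm _ (hvF 0) _ (hvF l.succ) q hq)
  intro x hx
  rw [Triangulation.hull, ← hvr, convexHull_range_eq_image] at hx
  obtain ⟨s, -, rfl⟩ := hx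
  have h0 : ∀ a ∈ F, feval u (affPt v s) ⬝ᵥ toC (a - v 0) = 0 := by
    intro a ha
    rw [← Finset.mem_coe, ← hvr] at ha
    obtain ⟨i, rfl⟩ := ha
    refine Fin.cases ?_ (fun l => key l s) i
    rw [sub_self, show toC 0 = 0 from funext fun i => by simp [toC], dotProduct_zero]
  intro a ha b hb
  have : b - a = (b - v 0) - (a - v 0) := by abel
  rw [this, toC_sub, dotProduct_sub, h0 a ha, h0 b hb, sub_zero]

end Unisolvence

/-! ### Sesquilinear forms and representation of functionals -/

section Sesquilinear

variable {V : Type*} [AddCommGroup V] [Module ℂ V]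

/-- A conjugate-linear functional. -/
structure IsConjLinear (g : V → ℂ) : Prop where
  add : ∀ u v, g (u + v) = g u + g v
  smul : ∀ (c : ℂ) u, g (c • u) = conj c * g u

/-- A form that is linear in its first and conjugate-linear in its second argument. -/
structure IsSesq (a : V → V → ℂ) : Prop where
  add_left : ∀ u v w, a (u + v) w = a u w + a v w
  smul_left : ∀ (c : ℂ) u w, a (c • u) w = c * a u w
  right : ∀ u, IsConjLinear (a u)

theorem IsSesq.sub_left {a : V → V → ℂ} (h : IsSesq a) (u v w : V) :
    a (u - v) w = a u w - a v w := by
  have := h.add_left (u - v) v w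
  rw [sub_add_cancel] at this
  linear_combination -this

theorem IsSesq.conj_swap {a : V → V → ℂ} (h : IsSesq a) : IsSesq fun w v => conj (a v w) where
  add_left u v w := by rw [(h.right w).add, map_add]
  smul_left c u w := by rw [(h.right w).smul, map_mul, Complex.conj_conj]
  right u := ⟨fun v w => by rw [h.add_left, map_add], fun c v => by rw [h.smul_left, map_mul]⟩

theorem IsConjLinear.eqOn_of_basis {W : Submodule ℂ V} {ι : Type*} (b : Module.Basis ι ℂ W)
    {g g' : V → ℂ} (hg : IsConjLinear g) (hg' : IsConjLinear g')
    (h : ∀ i, g (b i) = g' (b i)) : ∀ v ∈ W, g v = g' v := by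
  let lin : ∀ {f : V → ℂ}, IsConjLinear f → (W →ₗ[ℂ] ℂ) := fun {f} hf =>
    { toFun := fun v => conj (f v)
      map_add' := fun u v => by rw [Submodule.coe_add, hf.add, map_add]
      map_smul' := fun c u => by
        rw [Submodule.coe_smul, hf.smul, map_mul, Complex.conj_conj]; rfl }
  have hl : lin hg = lin hg' := b.ext fun i => congrArg conj (h i)
  intro v hv
  have := DFunLike.congr_fun hl ⟨v, hv⟩
  exact (starRingEnd ℂ).injective this

/-- A definite sesquilinear form on a finite-dimensional space represents every conjugate-linear
functional. -/
theorem IsSesq.exists_represent {a : V → V → ℂ} (ha : IsSesq a) (W : Submodule ℂ V)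
    [FiniteDimensional ℂ W] (hdef : ∀ u ∈ W, a u u = 0 → u = 0) {g : V → ℂ}
    (hg : IsConjLinear g) : ∃ u ∈ W, ∀ v ∈ W, a u v = g v := by
  let b := Module.finBasis ℂ W
  let L : W →ₗ[ℂ] (Fin (Module.finrank ℂ W) → ℂ) :=
    { toFun := fun u i => a u (b i)
      map_add' := fun u v => funext fun i => ha.add_left _ _ _
      map_smul' := fun c u => funext fun i => ha.smul_left _ _ _ }
  -- If a(u, ·) vanishes on the basis it vanishes on `W`, in particular at `u`, and definiteness
  -- applies.
  have hinj : Function.Injective L := by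
    rw [← LinearMap.ker_eq_bot, LinearMap.ker_eq_bot']
    intro u hu
    have h0 : IsConjLinear fun _ : V => (0 : ℂ) := ⟨by simp, by simp⟩
    have := (ha.right u).eqOn_of_basis b h0 fun i => congrFun hu i
    exact Subtype.ext (hdef u u.2 (this u u.2))
  have hsurj : Function.Surjective L :=
    (LinearMap.injective_iff_surjective_of_finrank_eq_finrank (by simp)).1 hinj
  obtain ⟨u, hu⟩ := hsurj fun i => g (b i)
  exact ⟨u, u.2, (ha.right u).eqOn_of_basis b hg fun i => congrFun hu i⟩

end Sesquilinear

/-! ### Piecewise L² inner products -/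

section L2

variable {ι m : Type*} {ν : ι → Measure E3}

/-- Piecewise square integrability, component by component. -/
def IsL2 (ν : ι → Measure E3) (f : ι → E3 → m → ℂ) : Prop :=
  ∀ i c, MemLp (fun x => f i x c) 2 (ν i)

theorem IsL2.add {f g : ι → E3 → m → ℂ} (hf : IsL2 ν f) (hg : IsL2 ν g) : IsL2 ν (f + g) :=
  fun i c => (hf i c).add (hg i c)

theorem IsL2.smul {f : ι → E3 → m → ℂ} (hf : IsL2 ν f) (a : ℂ) : IsL2 ν (a • f) :=
  fun i c => (hf i c).const_smul a

variable [Fintype m]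

theorem IsL2.integrable_dot {f g : ι → E3 → m → ℂ} (hf : IsL2 ν f) (hg : IsL2 ν g) (i : ι) :
    Integrable (fun x => f i x ⬝ᵥ star (g i x)) (ν i) := by
  simp only [dotProduct]
  exact integrable_finsetSum _ fun c _ => (hf i c).integrable_mul (hg i c).star

variable [Fintype ι]

/-- The `L²` inner product of piecewise defined vector fields. -/
def l2Inner (ν : ι → Measure E3) (f g : ι → E3 → m → ℂ) : ℂ :=
  ∑ i, ∫ x, f i x ⬝ᵥ star (g i x) ∂ν i

/-- The square of the `L²` norm of a piecewise defined vector field. -/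
def l2NormSq (ν : ι → Measure E3) (f : ι → E3 → m → ℂ) : ℝ :=
  ∑ i, ∫ x, ∑ c, ‖f i x c‖ ^ 2 ∂ν i

theorem l2Inner_add_left {f f' g : ι → E3 → m → ℂ} (hf : IsL2 ν f) (hf' : IsL2 ν f')
    (hg : IsL2 ν g) : l2Inner ν (f + f') g = l2Inner ν f g + l2Inner ν f' g := by
  simp only [l2Inner, ← Finset.sum_add_distrib]
  refine Finset.sum_congr rfl fun i _ => ?_
  rw [← integral_add (hf.integrable_dot hg i) (hf'.integrable_dot hg i)]
  simp only [Pi.add_apply, add_dotProduct]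

theorem l2Inner_smul_left (a : ℂ) (f g : ι → E3 → m → ℂ) :
    l2Inner ν (a • f) g = a * l2Inner ν f g := by
  simp only [l2Inner, Finset.mul_sum]
  refine Finset.sum_congr rfl fun i _ => ?_
  rw [← integral_const_mul]
  simp only [Pi.smul_apply, smul_dotProduct, smul_eq_mul]

theorem conj_l2Inner (f g : ι → E3 → m → ℂ) : conj (l2Inner ν f g) = l2Inner ν g f := by
  simp only [l2Inner, map_sum]
  refine Finset.sum_congr rfl fun i _ => ?_
  rw [← integral_conj]
  refine integral_congr_ae (.of_forall fun x => ?_)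
  simp only [dotProduct, map_sum, map_mul, Pi.star_apply, RCLike.star_def, Complex.conj_conj]
  exact Finset.sum_congr rfl fun c _ => mul_comm _ _

theorem l2Inner_add_right {f g g' : ι → E3 → m → ℂ} (hf : IsL2 ν f) (hg : IsL2 ν g)
    (hg' : IsL2 ν g') : l2Inner ν f (g + g') = l2Inner ν f g + l2Inner ν f g' := by
  rw [← conj_l2Inner, l2Inner_add_left hg hg' hf, map_add, conj_l2Inner, conj_l2Inner]

theorem l2Inner_smul_right (a : ℂ) (f g : ι → E3 → m → ℂ) :
    l2Inner ν f (a • g) = conj a * l2Inner ν f g := by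
  rw [← conj_l2Inner, l2Inner_smul_left, map_mul, conj_l2Inner]

theorem l2NormSq_nonneg (f : ι → E3 → m → ℂ) : 0 ≤ l2NormSq ν f :=
  Finset.sum_nonneg fun i _ => integral_nonneg fun x => Finset.sum_nonneg fun c _ => by positivity

theorem l2Inner_self (f : ι → E3 → m → ℂ) : l2Inner ν f f = (l2NormSq ν f : ℂ) := by
  simp only [l2Inner, l2NormSq, Complex.ofReal_sum]
  refine Finset.sum_congr rfl fun i _ => ?_
  rw [← integral_complex_ofReal]
  refine integral_congr_ae (.of_forall fun x => ?_)
  simp [dotProduct, Complex.mul_conj']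

theorem l2NormSq_add_smul {f g : ι → E3 → m → ℂ} (hf : IsL2 ν f) (hg : IsL2 ν g) (t : ℝ) :
    l2NormSq ν (f + (t : ℂ) • g) =
      l2NormSq ν f + 2 * t * (l2Inner ν f g).re + t ^ 2 * l2NormSq ν g := by
  have hg' := hg.smul (t : ℂ)
  have h := l2Inner_self (ν := ν) (f + (t : ℂ) • g)
  rw [l2Inner_add_left hf hg' (hf.add hg'), l2Inner_add_right hf hf hg',
    l2Inner_add_right hg' hf hg', l2Inner_smul_left, l2Inner_smul_right, l2Inner_smul_left,
    l2Inner_smul_right, l2Inner_self, l2Inner_self, ← conj_l2Inner f g] at h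
  have h' := congrArg Complex.re h
  simp at h'
  linear_combination -h'

end L2

/-! ### Matrix coefficients and their inverses -/

section Coefficients

variable {M : Matrix (Fin 3) (Fin 3) ℝ}

theorem isUnit_det_of_coercive {c : ℝ} (hc : 0 < c)
    (h : ∀ v : Fin 3 → ℝ, c * (v ⬝ᵥ v) ≤ v ⬝ᵥ M *ᵥ v) : IsUnit M.det := by
  rw [isUnit_iff_ne_zero]
  intro h0
  obtain ⟨v, hv, hv0⟩ := Matrix.exists_mulVec_eq_zero_iff.2 h0
  have h1 := h v
  rw [hv0, dotProduct_zero] at h1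
  have h2 : 0 ≤ v ⬝ᵥ v := Finset.sum_nonneg fun i _ => mul_self_nonneg _
  exact hv (dotProduct_self_eq_zero.1 (by nlinarith))

/-- For the column w = M⁻¹e_j, coercivity gives c|w|² ≤ w · Mw = w_j ≤ |w|, so |w| ≤ 1/c. This
bounds μ⁻¹ by the ellipticity constant of μ. -/
theorem abs_inv_apply_le_of_coercive {c : ℝ} (hc : 0 < c)
    (h : ∀ v : Fin 3 → ℝ, c * (v ⬝ᵥ v) ≤ v ⬝ᵥ M *ᵥ v) (i j : Fin 3) : |M⁻¹ i j| ≤ 1 / c := by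
  set w : Fin 3 → ℝ := M⁻¹ *ᵥ Pi.single j 1 with hw
  have hM : M *ᵥ w = Pi.single j 1 := by
    rw [hw, Matrix.mulVec_mulVec, Matrix.mul_nonsing_inv _ (isUnit_det_of_coercive hc h),
      Matrix.one_mulVec]
  have h1 := h w
  rw [hM, dotProduct_single_one] at h1
  have hsq : ∀ l, w l ^ 2 ≤ w ⬝ᵥ w := fun l => by
    rw [dotProduct, sq]
    exact Finset.single_le_sum (f := fun l => w l * w l) (fun l _ => mul_self_nonneg _)
      (Finset.mem_univ l)
  have hwi : M⁻¹ i j = w i := by simp [hw]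
  have hj : w j ≤ 1 / c := by
    rw [le_div_iff₀ hc]
    by_contra! hcon
    have h3 : c * w j ^ 2 ≤ w j := (mul_le_mul_of_nonneg_left (hsq j) hc.le).trans h1
    have h4 : 0 < w j := pos_of_mul_pos_left (one_pos.trans hcon) hc.le
    nlinarith
  rw [hwi]
  refine abs_le_of_sq_le_sq ?_ (by positivity)
  have h2 : w ⬝ᵥ w ≤ 1 / c * (1 / c) := by
    rw [one_div_mul_eq_div, le_div_iff₀ hc]
    linarith
  nlinarith [hsq i]

/-- By symmetry the mixed terms between real and imaginary parts cancel, so the Hermitian form is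
real and inherits coercivity from the real one. -/
theorem map_mulVec_dotProduct_star (hM : M.IsSymm) (p : Fin 3 → ℂ) :
    (M.map (algebraMap ℝ ℂ) *ᵥ p) ⬝ᵥ star p =
      (((fun i => (p i).re) ⬝ᵥ M *ᵥ (fun i => (p i).re) +
        (fun i => (p i).im) ⬝ᵥ M *ᵥ (fun i => (p i).im) : ℝ) : ℂ) := by
  have h10 := hM.apply 0 1
  have h20 := hM.apply 0 2
  have h21 := hM.apply 1 2
  apply Complex.ext
  · simp [Matrix.mulVec, dotProduct, Fin.sum_univ_three, h10, h20, h21]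
    ring
  · simp [Matrix.mulVec, dotProduct, Fin.sum_univ_three, h10, h20, h21]
    ring

variable {Ω : Set E3} {A : E3 → Matrix (Fin 3) (Fin 3) ℝ}

theorem IsCoefficient.inv_bounded (hA : IsCoefficient Ω A) (i j : Fin 3) :
    MemLp (fun x => (A x)⁻¹ i j) ⊤ (volume.restrict Ω) := by
  obtain ⟨c, hc, hpos⟩ := hA.pos
  have hm : ∀ i j, AEMeasurable (fun x => A x i j) (volume.restrict Ω) := fun i j =>
    (hA.bounded i j).aestronglyMeasurable.aemeasurable
  refine memLp_top_of_bound (C := 1 / c) ?_ ?_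
  · refine AEMeasurable.aestronglyMeasurable ?_
    have hdet : AEMeasurable (fun x => (A x).det) (volume.restrict Ω) := by
      simp only [Matrix.det_fin_three]
      fun_prop
    have hadj : AEMeasurable (fun x => (A x).adjugate i j) (volume.restrict Ω) := by
      simp only [Matrix.adjugate_fin_three]
      fin_cases i <;> fin_cases j <;> simp <;> fun_prop
    simp only [Matrix.inv_def, Ring.inverse_eq_inv', Matrix.smul_apply, smul_eq_mul]
    exact hdet.inv.mul hadj
  · filter_upwards [hpos] with x hx
    exact abs_inv_apply_le_of_coercive hc hx i j

theorem IsCoefficient.inv_symm (hA : IsCoefficient Ω A) :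
    ∀ᵐ x ∂(volume.restrict Ω), ((A x)⁻¹).IsSymm := by
  filter_upwards [hA.symm] with x hx
  exact hx.inv

variable {ι : Type*} {ν : ι → Measure E3}

theorem IsL2.mulVec {f : ι → E3 → Fin 3 → ℂ} (hf : IsL2 ν f) (hν : ∀ i, ν i ≤ volume.restrict Ω)
    (hA : ∀ i j, MemLp (fun x => A x i j) ⊤ (volume.restrict Ω)) :
    IsL2 ν fun i x => (A x).map (algebraMap ℝ ℂ) *ᵥ f i x := by
  intro i c
  simp only [Matrix.mulVec, dotProduct, Matrix.map_apply]
  refine memLp_finsetSum _ fun l _ => ?_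
  refine (hf i l).mul' ?_ (p := ⊤) (r := 2)
  exact ((hA c l).mono_measure (hν i)).ofReal

end Coefficients

/-! ### The form a on piecewise polynomial fields and its definiteness -/

theorem feval_add (p q : PolyField) (x : E3) : feval (p + q) x = feval p x + feval q x :=
  funext fun i => by simp [feval, peval]

theorem feval_smul (c : ℂ) (p : PolyField) (x : E3) : feval (c • p) x = c • feval p x :=
  funext fun i => by simp [feval, peval, smul_eval]

theorem feval_sub (p q : PolyField) (x : E3) : feval (p - q) x = feval p x - feval q x :=
  funext fun i => by simp [feval, peval]

theorem pcurl_add (p q : PolyField) : pcurl (p + q) = pcurl p + pcurl q := by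
  funext i
  fin_cases i <;> simp [pcurl] <;> ring

theorem pcurl_smul (c : ℂ) (p : PolyField) : pcurl (c • p) = c • pcurl p := by
  funext i
  fin_cases i <;> simp [pcurl, smul_sub]

namespace Triangulation

variable {Ω : Set E3} (T : Triangulation Ω)

/-- Lebesgue measure on the tetrahedra of the mesh. -/
def cellMeasure (K : T.cells) : Measure E3 := volume.restrict (hull K.1)

theorem mem_faces_of_cell (K : T.cells) : K.1 ∈ T.complex.faces ∧ K.1.card = 4 := by
  have h := K.2
  simpa only [cells, Finset.mem_filter, Set.Finite.mem_toFinset] using h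

theorem isCompact_hull (s : Finset E3) : IsCompact (hull s) :=
  s.finite_toSet.isCompact_convexHull ℝ

theorem interior_hull_nonempty (K : T.cells) : (interior (hull K.1)).Nonempty := by
  obtain ⟨hK, hc⟩ := T.mem_faces_of_cell K
  rw [hull, interior_convexHull_nonempty_iff_affineSpan_eq_top]
  have h := (T.complex.indep hK).affineSpan_eq_top_iff_card_eq_finrank_add_one.2 (by simp [hc])
  simpa using h

/-- The open tetrahedron lies in the interior of closure Ω, which is Ω, and the frontier of a convex
set is null. Almost-everywhere and integrability assumptions on Ω thereby pass to each tetrahedron.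
-/
theorem cellMeasure_le (hreg : interior (closure Ω) = Ω) (K : T.cells) :
    T.cellMeasure K ≤ volume.restrict Ω := by
  refine Measure.restrict_mono_ae ?_
  have hsub : interior (hull K.1) ⊆ Ω := by
    have h := T.complex.convexHull_subset_space (T.mem_faces_of_cell K).1
    rw [T.space_eq] at h
    exact (interior_mono h).trans hreg.le
  have hint : (interior (hull K.1) : Set E3) =ᵐ[volume] hull K.1 :=
    interior_ae_eq_of_null_frontier ((convex_convexHull ℝ _).addHaar_frontier volume)
  exact hint.symm.le.trans (Filter.Eventually.of_forall hsub)

instance (K : T.cells) : IsFiniteMeasure (T.cellMeasure K) :=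
  ⟨by simpa [cellMeasure] using (isCompact_hull K.1).measure_lt_top⟩

theorem memLp_restrict_of_continuous {ν : Measure E3} {H : Set E3} (hH : IsCompact H)
    [IsFiniteMeasure (ν.restrict H)] {f : E3 → ℂ} (hf : Continuous f) :
    MemLp f 2 (ν.restrict H) := by
  obtain ⟨C, hC⟩ := hH.exists_bound_of_continuousOn hf.continuousOn
  refine MemLp.of_bound hf.aestronglyMeasurable C ?_
  rw [ae_restrict_iff' hH.measurableSet]
  exact .of_forall hC

theorem memLp_of_continuous (K : T.cells) {f : E3 → ℂ} (hf : Continuous f) :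
    MemLp f 2 (T.cellMeasure K) :=
  have : IsFiniteMeasure (volume.restrict (hull K.1)) :=
    inferInstanceAs (IsFiniteMeasure (T.cellMeasure K))
  memLp_restrict_of_continuous (isCompact_hull K.1) hf

/-- The function field of a finite element field, as a linear map. -/
def fnLin : T.Field →ₗ[ℂ] (T.cells → E3 → Fin 3 → ℂ) where
  toFun := T.fn
  map_add' u v := by funext K x; exact feval_add _ _ _
  map_smul' c u := by funext K x; exact feval_smul _ _ _

/-- The piecewise curl of a finite element field, as a linear map. -/
def curlLin : T.Field →ₗ[ℂ] (T.cells → E3 → Fin 3 → ℂ) where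
  toFun u K x := feval (pcurl (u K)) x
  map_add' u v := by funext K x; simp only [Pi.add_apply, pcurl_add, feval_add]
  map_smul' c u := by
    funext K x; simp only [Pi.smul_apply, pcurl_smul, feval_smul, RingHom.id_apply]

theorem isL2_feval (p : T.cells → PolyField) : IsL2 T.cellMeasure fun K x => feval (p K) x :=
  fun K c => T.memLp_of_continuous K (continuous_peval (p K c))

theorem isSesq_weighted (hreg : interior (closure Ω) = Ω) {A : E3 → Matrix (Fin 3) (Fin 3) ℝ}
    (hA : ∀ i j, MemLp (fun x => A x i j) ⊤ (volume.restrict Ω))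
    (D : T.Field →ₗ[ℂ] (T.cells → E3 → Fin 3 → ℂ)) (hD : ∀ u, IsL2 T.cellMeasure (D u)) :
    IsSesq fun u v => l2Inner T.cellMeasure
      (fun K x => (A x).map (algebraMap ℝ ℂ) *ᵥ D u K x) (D v) := by
  have hAD := fun u => (hD u).mulVec (T.cellMeasure_le hreg) hA
  refine ⟨fun u v w => ?_, fun c u w => ?_, fun u => ⟨fun v w => ?_, fun c v => ?_⟩⟩
  · rw [← l2Inner_add_left (hAD u) (hAD v) (hD w)]
    congr 1
    funext K x
    simp only [map_add, Pi.add_apply, Matrix.mulVec_add]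
  · rw [← l2Inner_smul_left]
    congr 1
    funext K x
    simp only [map_smul, Pi.smul_apply, Matrix.mulVec_smul]
  · rw [map_add, l2Inner_add_right (hAD u) (hD v) (hD w)]
  · rw [map_smul, l2Inner_smul_right]

variable {μ κ : E3 → Matrix (Fin 3) (Fin 3) ℝ}

theorem isSesq_aForm (hreg : interior (closure Ω) = Ω) (hμ : IsCoefficient Ω μ)
    (hκ : IsCoefficient Ω κ) (ω : ℝ) : IsSesq (T.aForm μ κ ω) := by
  have h1 := T.isSesq_weighted hreg hμ.inv_bounded T.curlLin fun u => T.isL2_feval _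
  have h2 := T.isSesq_weighted hreg hκ.bounded T.fnLin fun u => T.isL2_feval _
  have h : T.aForm μ κ ω = fun u v =>
      l2Inner T.cellMeasure (fun K x => (μ x)⁻¹.map (algebraMap ℝ ℂ) *ᵥ T.curlLin u K x)
        (T.curlLin v) + Complex.I * (ω : ℂ) *
      l2Inner T.cellMeasure (fun K x => (κ x).map (algebraMap ℝ ℂ) *ᵥ T.fnLin u K x)
        (T.fnLin v) := rfl
  rw [h]
  refine ⟨fun u v w => ?_, fun c u w => ?_, fun u => ⟨fun v w => ?_, fun c v => ?_⟩⟩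
  · linear_combination h1.add_left u v w + Complex.I * (ω : ℂ) * h2.add_left u v w
  · linear_combination h1.smul_left c u w + Complex.I * (ω : ℂ) * h2.smul_left c u w
  · linear_combination (h1.right u).add v w + Complex.I * (ω : ℂ) * (h2.right u).add v w
  · linear_combination (h1.right u).smul c v + Complex.I * (ω : ℂ) * (h2.right u).smul c v

theorem l2Inner_weighted_im (hreg : interior (closure Ω) = Ω)
    {A : E3 → Matrix (Fin 3) (Fin 3) ℝ} (hA : ∀ᵐ x ∂(volume.restrict Ω), (A x).IsSymm)
    (f : T.cells → E3 → Fin 3 → ℂ) :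
    (l2Inner T.cellMeasure (fun K x => (A x).map (algebraMap ℝ ℂ) *ᵥ f K x) f).im = 0 := by
  rw [l2Inner, Complex.im_sum]
  refine Finset.sum_eq_zero fun K _ => ?_
  have h : (fun x => ((A x).map (algebraMap ℝ ℂ) *ᵥ f K x) ⬝ᵥ star (f K x))
      =ᵐ[T.cellMeasure K] fun x => (((((fun i => (f K x i).re) ⬝ᵥ A x *ᵥ (fun i => (f K x i).re) +
        (fun i => (f K x i).im) ⬝ᵥ A x *ᵥ (fun i => (f K x i).im)) : ℝ)) : ℂ) := by
    filter_upwards [ae_mono (T.cellMeasure_le hreg K) hA] with x hx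
    exact map_mulVec_dotProduct_star hx _
  rw [integral_congr_ae h, integral_complex_ofReal, Complex.ofReal_im]

theorem le_re_l2Inner_weighted (hreg : interior (closure Ω) = Ω) (hκ : IsCoefficient Ω κ) :
    ∃ c : ℝ, 0 < c ∧ ∀ f, IsL2 T.cellMeasure f → c * l2NormSq T.cellMeasure f ≤
      (l2Inner T.cellMeasure (fun K x => (κ x).map (algebraMap ℝ ℂ) *ᵥ f K x) f).re := by
  obtain ⟨c, hc, hpos⟩ := hκ.pos
  refine ⟨c, hc, fun f hf => ?_⟩
  have hκf := hf.mulVec (T.cellMeasure_le hreg) hκ.bounded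
  rw [l2NormSq, l2Inner, Complex.re_sum, Finset.mul_sum]
  refine Finset.sum_le_sum fun K _ => ?_
  have hint := hκf.integrable_dot hf K
  have hre : (∫ x, ((κ x).map (algebraMap ℝ ℂ) *ᵥ f K x) ⬝ᵥ star (f K x) ∂T.cellMeasure K).re =
      ∫ x, (((κ x).map (algebraMap ℝ ℂ) *ᵥ f K x) ⬝ᵥ star (f K x)).re ∂T.cellMeasure K :=
    (integral_re hint).symm
  rw [hre, ← integral_const_mul]
  refine integral_mono_ae ?_ hint.re ?_
  · refine Integrable.const_mul ?_ c
    exact integrable_finsetSum _ fun i _ => (hf K i).integrable_norm_pow (by norm_num)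
  · filter_upwards [ae_mono (T.cellMeasure_le hreg K) hκ.symm,
      ae_mono (T.cellMeasure_le hreg K) hpos] with x hx hx'
    simp only [map_mulVec_dotProduct_star hx, Complex.ofReal_re]
    refine le_trans (le_of_eq ?_) (add_le_add (hx' _) (hx' _))
    rw [← mul_add, dotProduct, dotProduct, ← Finset.sum_add_distrib]
    congr 1
    refine Finset.sum_congr rfl fun i _ => ?_
    rw [← Complex.normSq_eq_norm_sq, Complex.normSq_apply]

/-- Each tetrahedron has nonempty interior, where the continuous integrand must vanish pointwise; a
polynomial zero on an open set is zero. The cells are treated independently, so conformity plays no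
role. -/
theorem eq_zero_of_l2NormSq_fn_eq_zero {u : T.Field}
    (h : l2NormSq T.cellMeasure (T.fn u) = 0) : u = 0 := by
  have hK := (Finset.sum_eq_zero_iff_of_nonneg fun K _ => integral_nonneg fun x =>
    Finset.sum_nonneg fun c _ => by positivity).1 h
  funext K i
  have hcont : Continuous fun x => ∑ c, ‖T.fn u K x c‖ ^ 2 :=
    continuous_finsetSum _ fun c _ => (continuous_peval (u K c)).norm.pow 2
  have h1 := (integral_eq_zero_iff_of_nonneg
    (fun x => Finset.sum_nonneg fun c _ => by positivity)
    (integrable_finsetSum _ fun c _ =>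
      (T.isL2_feval u K c).integrable_norm_pow (by norm_num))).1 (hK K (Finset.mem_univ K))
  have h2 := Measure.eqOn_open_of_ae_eq
    (ae_mono (Measure.restrict_mono interior_subset le_rfl) h1) isOpen_interior
    hcont.continuousOn continuousOn_const
  let φ : (Fin 3 → ℝ) → E3 := WithLp.toLp 2
  have hφ : Continuous φ := PiLp.continuous_toLp 2 _
  refine eq_zero_of_eval_eq_zero_on_open (U := φ ⁻¹' interior (hull K.1))
    (isOpen_interior.preimage hφ) ?_ (fun s hs => ?_)
  · obtain ⟨x, hx⟩ := T.interior_hull_nonempty K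
    exact ⟨WithLp.ofLp x, hx⟩
  · have h3 := (Finset.sum_eq_zero_iff_of_nonneg fun c _ => by positivity).1 (h2 hs) i
      (Finset.mem_univ i)
    have h4 : feval (u K) (φ s) i = 0 := by simpa using h3
    exact h4

/-- The curl term is real, so the imaginary part alone yields ω (κu, u) = 0, and coercivity of κ
gives zero norm. No estimate of the curl is involved. -/
theorem aForm_definite (hreg : interior (closure Ω) = Ω) (hμ : IsCoefficient Ω μ)
    (hκ : IsCoefficient Ω κ) {ω : ℝ} (hω : ω ≠ 0) {u : T.Field} (h : T.aForm μ κ ω u u = 0) :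
    u = 0 := by
  obtain ⟨c, hc, hle⟩ := T.le_re_l2Inner_weighted hreg hκ
  have h1 := T.l2Inner_weighted_im hreg hμ.inv_symm (T.curlLin u)
  have h2 := hle (T.fn u) (T.isL2_feval u)
  have h3 : (l2Inner T.cellMeasure
      (fun K x => (μ x)⁻¹.map (algebraMap ℝ ℂ) *ᵥ T.curlLin u K x) (T.curlLin u) +
      Complex.I * (ω : ℂ) *
      l2Inner T.cellMeasure (fun K x => (κ x).map (algebraMap ℝ ℂ) *ᵥ T.fn u K x) (T.fn u)).im =
      0 := congrArg Complex.im h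
  rw [Complex.add_im, h1, zero_add, mul_assoc, Complex.I_mul_im, Complex.re_ofReal_mul] at h3
  have h4 := (mul_eq_zero.1 h3).resolve_left hω
  rw [h4] at h2
  refine T.eq_zero_of_l2NormSq_fn_eq_zero (le_antisymm ?_ (l2NormSq_nonneg _))
  by_contra! hcon
  nlinarith [mul_pos hc hcon]

end Triangulation

/-! ### Cross product identities for tangential traces -/

section CrossProduct

theorem cross_cross_cross_self {n : Fin 3 → ℂ} (hn : n ⬝ᵥ n = 1) (v : Fin 3 → ℂ) :
    (n ⨯₃ (v ⨯₃ n)) ⨯₃ n = v ⨯₃ n := by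
  have h : n 0 * n 0 + n 1 * n 1 + n 2 * n 2 = 1 := by
    simpa [dotProduct, Fin.sum_univ_three] using hn
  funext i
  fin_cases i
  · simp [cross_apply]; linear_combination (v 1 * n 2 - v 2 * n 1) * h
  · simp [cross_apply]; linear_combination (v 2 * n 0 - v 0 * n 2) * h
  · simp [cross_apply]; linear_combination (v 0 * n 1 - v 1 * n 0) * h

theorem cross_cross_dotProduct {n w : Fin 3 → ℂ} (hn : n ⬝ᵥ n = 1) (hw : n ⬝ᵥ w = 0)
    (v : Fin 3 → ℂ) : (n ⨯₃ (v ⨯₃ n)) ⬝ᵥ w = v ⬝ᵥ w := by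
  simp only [dotProduct, Fin.sum_univ_three] at hn hw
  simp [cross_apply, dotProduct, Fin.sum_univ_three]
  linear_combination (v 0 * w 0 + v 1 * w 1 + v 2 * w 2) * hn -
    (n 0 * v 0 + n 1 * v 1 + n 2 * v 2) * hw

/-- The vector u × n is both parallel and orthogonal to m. The dot product is bilinear over ℂ, so m
· m ≠ 0 is stronger than m ≠ 0; for cross products of real edges it comes from
`toC_cross_toC_ne_zero`. -/
theorem cross_eq_zero_of_dotProduct_eq_zero {m u n : Fin 3 → ℂ} (hm : m ⬝ᵥ m ≠ 0)
    (hu : m ⨯₃ u = 0) (hn : m ⨯₃ n = 0) : u ⨯₃ n = 0 := by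
  have h1 : m ⨯₃ (u ⨯₃ n) = 0 := by rw [leibniz_cross, hu, hn]; simp
  have h2 : m ⬝ᵥ (u ⨯₃ n) = 0 := by
    rw [triple_product_permutation, triple_product_permutation, hu, dotProduct_zero]
  generalize u ⨯₃ n = c at h1 h2
  have e0 := congrFun h1 0
  have e1 := congrFun h1 1
  have e2 := congrFun h1 2
  simp only [cross_apply, dotProduct, Fin.sum_univ_three, Matrix.cons_val_zero,
    Matrix.cons_val_one, Matrix.cons_val, Pi.zero_apply] at e0 e1 e2 h2 hm
  funext i
  apply (mul_eq_zero.1 (?_ : _ * c i = 0)).resolve_left hm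
  fin_cases i
  · simp only [Fin.zero_eta]; linear_combination m 0 * h2 - m 1 * e2 + m 2 * e1
  · simp only [Fin.mk_one]; linear_combination m 1 * h2 - m 2 * e0 + m 0 * e2
  · simp only [Fin.reduceFinMk]; linear_combination m 2 * h2 - m 0 * e1 + m 1 * e0

theorem cross_cross_eq_zero {e e' u : Fin 3 → ℂ} (h : u ⬝ᵥ e = 0) (h' : u ⬝ᵥ e' = 0) :
    (e ⨯₃ e') ⨯₃ u = 0 := by
  simp only [dotProduct, Fin.sum_univ_three] at h h'
  funext i
  fin_cases i
  · simp [cross_apply]; linear_combination e' 0 * h - e 0 * h'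
  · simp [cross_apply]; linear_combination e' 1 * h - e 1 * h'
  · simp [cross_apply]; linear_combination e' 2 * h - e 2 * h'

theorem toC_cross_toC_ne_zero {e e' : E3} (h : LinearIndependent ℝ ![e, e']) :
    (toC e ⨯₃ toC e') ⬝ᵥ (toC e ⨯₃ toC e') ≠ 0 := by
  have h1 : LinearIndependent ℝ ![WithLp.ofLp e, WithLp.ofLp e'] := by
    have := h.map' (WithLp.linearEquiv 2 ℝ (Fin 3 → ℝ)).toLinearMap (LinearEquiv.ker _)
    have hfun : (WithLp.linearEquiv 2 ℝ (Fin 3 → ℝ)).toLinearMap ∘ ![e, e'] =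
        ![WithLp.ofLp e, WithLp.ofLp e'] := by
      funext i
      fin_cases i <;> rfl
    rwa [hfun] at this
  have h2 := crossProduct_ne_zero_iff_linearIndependent.2 h1
  have h3 : toC e ⨯₃ toC e' = fun i => (((WithLp.ofLp e ⨯₃ WithLp.ofLp e') i : ℝ) : ℂ) := by
    funext i
    fin_cases i <;> simp [cross_apply, toC]
  rw [h3]
  have h4 : ((fun i => (((WithLp.ofLp e ⨯₃ WithLp.ofLp e') i : ℝ) : ℂ)) ⬝ᵥ
      fun i => (((WithLp.ofLp e ⨯₃ WithLp.ofLp e') i : ℝ) : ℂ)) =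
      (((WithLp.ofLp e ⨯₃ WithLp.ofLp e') ⬝ᵥ (WithLp.ofLp e ⨯₃ WithLp.ofLp e') : ℝ) : ℂ) := by
    simp [dotProduct]
  rw [h4]
  exact_mod_cast fun h5 => h2 (dotProduct_self_eq_zero.1 h5)

theorem toC_dotProduct_toC (x y : E3) : toC x ⬝ᵥ toC y = ((inner ℝ x y : ℝ) : ℂ) := by
  simp [toC, dotProduct, PiLp.inner_apply, mul_comm]

theorem feval_cross (p q : PolyField) (x : E3) :
    feval (p ⨯₃ q) x = feval p x ⨯₃ feval q x := by
  funext i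
  fin_cases i <;> simp [cross_apply, feval, peval]

end CrossProduct

/-! ### Normals and tangential traces on boundary faces -/

namespace Triangulation

variable {Ω : Set E3} (T : Triangulation Ω)

theorem mem_faces_of_bface (F : T.bfaces) : F.1 ∈ T.complex.faces ∧ F.1.card = 3 := by
  have h := F.2
  simp only [bfaces, Finset.mem_filter, Set.Finite.mem_toFinset] at h
  exact ⟨h.1, h.2.1⟩

theorem subset_adj (F : T.bfaces) : F.1 ⊆ (T.adj F).1 := (T.exists_adj F).choose_spec

/-- The defining choice needs a witness: take the component of p - a₀ orthogonal to the face, where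
p is the opposite vertex, then normalize and reverse it. It is nonzero because the four vertices are
affinely independent. -/
theorem normal_spec (F : T.bfaces) :
    ‖T.normal F‖ = 1 ∧ (∀ a ∈ F.1, ∀ b ∈ F.1, inner ℝ (T.normal F) (b - a) = 0) ∧
      ∀ a ∈ F.1, ∀ p ∈ (T.adj F).1, p ∉ F.1 → inner ℝ (T.normal F) (p - a) < 0 := by
  apply Classical.epsilon_spec (p := fun n : E3 =>
    ‖n‖ = 1 ∧ (∀ a ∈ F.1, ∀ b ∈ F.1, inner ℝ n (b - a) = 0) ∧
      ∀ a ∈ F.1, ∀ p ∈ (T.adj F).1, p ∉ F.1 → inner ℝ n (p - a) < 0)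
  obtain ⟨a₀, ha₀⟩ := T.bface_nonempty F
  obtain ⟨hK, hK4⟩ := T.mem_faces_of_cell (T.adj F)
  have hF3 := (T.mem_faces_of_bface F).2
  have hFK := T.subset_adj F
  classical
  obtain ⟨p, hp⟩ : ∃ p, (T.adj F).1 \ F.1 = {p} := Finset.card_eq_one.1 (by
    rw [Finset.card_sdiff_of_subset hFK, hK4, hF3])
  have hpK : p ∈ (T.adj F).1 \ F.1 := by rw [hp]; exact Finset.mem_singleton_self p
  rw [Finset.mem_sdiff] at hpK
  set S : Submodule ℝ E3 := vectorSpan ℝ (F.1 : Set E3) with hS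
  have hpS : p - a₀ ∉ S := by
    intro hmem
    have h1 : p ∈ affineSpan ℝ (F.1 : Set E3) := by
      have h2 := AffineSubspace.vadd_mem_of_mem_direction
        (s := affineSpan ℝ (F.1 : Set E3)) (v := p - a₀)
        (by rw [direction_affineSpan]; exact hmem) (subset_affineSpan ℝ _ (Finset.mem_coe.2 ha₀))
      simpa using h2
    have h3 := (T.complex.indep hK).mem_affineSpan_iff ⟨p, hpK.1⟩ {x | x.1 ∈ F.1}
    have h4 : (fun x : (T.adj F).1 => (x : E3)) '' {x | x.1 ∈ F.1} = F.1 := by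
      ext x
      constructor
      · rintro ⟨y, hy, rfl⟩
        exact hy
      · intro hx
        exact ⟨⟨x, hFK hx⟩, hx, rfl⟩
    rw [h4] at h3
    exact hpK.2 (h3.1 h1)
  set q := (p - a₀) - S.starProjection (p - a₀) with hq
  have hqS : q ∈ Sᗮ := S.sub_starProjection_mem_orthogonal _
  have hq0 : q ≠ 0 := by
    intro h0
    refine hpS ?_
    rw [sub_eq_zero.1 h0]
    exact Submodule.starProjection_apply_mem _ _
  have horth : ∀ w ∈ S, inner ℝ q w = 0 := fun w hw => by
    rw [real_inner_comm]; exact hqS w hw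
  have hqp : inner ℝ q (p - a₀) = ‖q‖ ^ 2 := by
    have : p - a₀ = q + S.starProjection (p - a₀) := by rw [hq]; abel
    rw [this, inner_add_right, horth _ (Submodule.starProjection_apply_mem _ _), add_zero,
      real_inner_self_eq_norm_sq]
  have hdiff : ∀ a ∈ F.1, ∀ b ∈ F.1, b - a ∈ S := fun a ha b hb =>
    vsub_mem_vectorSpan ℝ (Finset.mem_coe.2 hb) (Finset.mem_coe.2 ha)
  have hqn : 0 < ‖q‖ := norm_pos_iff.2 hq0
  refine ⟨-(‖q‖⁻¹ • q), ?_, ?_, ?_⟩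
  · rw [norm_neg, norm_smul, norm_inv, norm_norm, inv_mul_cancel₀ hqn.ne']
  · intro a ha b hb
    rw [inner_neg_left, real_inner_smul_left, horth _ (hdiff a ha b hb), mul_zero, neg_zero]
  · intro a ha r hr hrF
    have hrp : r = p := by
      have : r ∈ (T.adj F).1 \ F.1 := Finset.mem_sdiff.2 ⟨hr, hrF⟩
      rw [hp] at this
      exact Finset.mem_singleton.1 this
    have : r - a = (p - a₀) + (a₀ - a) := by rw [hrp]; abel
    rw [inner_neg_left, real_inner_smul_left, this, inner_add_right, hqp,
      horth _ (hdiff a ha a₀ ha₀), add_zero]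
    have : 0 < ‖q‖⁻¹ * ‖q‖ ^ 2 := by positivity
    linarith

theorem normal_dotProduct_self (F : T.bfaces) :
    toC (T.normal F) ⬝ᵥ toC (T.normal F) = 1 := by
  rw [toC_dotProduct_toC, real_inner_self_eq_norm_sq, (T.normal_spec F).1]
  simp

theorem normal_dotProduct_edge (F : T.bfaces) {a b : E3} (ha : a ∈ F.1) (hb : b ∈ F.1) :
    toC (T.normal F) ⬝ᵥ toC (b - a) = 0 := by
  rw [toC_dotProduct_toC, (T.normal_spec F).2.1 a ha b hb, Complex.ofReal_zero]

theorem normal_inner_of_mem_hull (F : T.bfaces) {a x : E3} (ha : a ∈ F.1) (hx : x ∈ hull F.1) :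
    inner ℝ (T.normal F) (x - a) = 0 := by
  have hconv : Convex ℝ {y : E3 | inner ℝ (T.normal F) y = inner ℝ (T.normal F) a} :=
    convex_hyperplane (innerₛₗ ℝ (T.normal F)).isLinear _
  have h := convexHull_min (fun b hb => ?_) hconv hx
  · rw [inner_sub_right, sub_eq_zero]
    exact h
  · have := (T.normal_spec F).2.1 a ha b hb
    rwa [inner_sub_right, sub_eq_zero] at this

theorem feval_normalExt (F : T.bfaces) (p : PolyField) {x : E3} (hx : x ∈ hull F.1) :
    feval (T.normalExt F p) x = feval p x := by
  have h := T.normal_inner_of_mem_hull F (T.bface_nonempty F).choose_spec hx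
  have h' := congrArg (fun r : ℝ => (r : ℂ)) h
  simp only [← toC_dotProduct_toC, dotProduct, toC, Complex.ofReal_zero, PiLp.sub_apply,
    Complex.ofReal_sub] at h'
  funext i
  rw [feval, feval, normalExt, peval, peval]
  refine (eval_aeval_eq _ _ _).trans ?_
  congr 2
  funext l
  simp only [map_sub, map_mul, map_sum, eval_X, eval_C, toC, h', mul_zero, sub_zero]

theorem feval_gammaT_cross (u : T.Field) (F : T.bfaces) {x : E3} (hx : x ∈ hull F.1) :
    feval (T.gammaT u F) x ⨯₃ toC (T.normal F) =
      feval (u (T.adj F)) x ⨯₃ toC (T.normal F) := by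
  have hn : feval (fun i => C ((T.normal F i : ℝ) : ℂ)) x = toC (T.normal F) := by
    funext i
    simp [feval, peval, toC]
  rw [gammaT]
  simp only [feval_cross, hn, T.feval_normalExt F _ hx]
  exact cross_cross_cross_self (T.normal_dotProduct_self F) _

theorem tangential_eq_of_cross_eq (F : T.bfaces) {u v : Fin 3 → ℂ}
    (h : u ⨯₃ toC (T.normal F) = v ⨯₃ toC (T.normal F)) {a b : E3} (ha : a ∈ F.1)
    (hb : b ∈ F.1) : u ⬝ᵥ toC (b - a) = v ⬝ᵥ toC (b - a) := by
  rw [← cross_cross_dotProduct (T.normal_dotProduct_self F) (T.normal_dotProduct_edge F ha hb) u,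
    h, cross_cross_dotProduct (T.normal_dotProduct_self F) (T.normal_dotProduct_edge F ha hb)]

theorem cross_normal_eq_zero (F : T.bfaces) {u : Fin 3 → ℂ}
    (h : ∀ a ∈ F.1, ∀ b ∈ F.1, u ⬝ᵥ toC (b - a) = 0) : u ⨯₃ toC (T.normal F) = 0 := by
  obtain ⟨hF, hc⟩ := T.mem_faces_of_bface F
  obtain ⟨v, -, hvr, hv⟩ := exists_enumeration hc (T.complex.indep hF)
  have hvF : ∀ i, v i ∈ F.1 := fun i => by
    have : v i ∈ Set.range v := ⟨i, rfl⟩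
    rw [hvr] at this
    exact this
  have hv' : LinearIndependent ℝ ![v 1 - v 0, v 2 - v 0] := by
    convert hv using 1
    funext i
    fin_cases i <;> rfl
  refine cross_eq_zero_of_dotProduct_eq_zero (toC_cross_toC_ne_zero hv')
    (cross_cross_eq_zero (h _ (hvF 0) _ (hvF 1)) (h _ (hvF 0) _ (hvF 2)))
    (cross_cross_eq_zero (T.normal_dotProduct_edge F (hvF 0) (hvF 1))
      (T.normal_dotProduct_edge F (hvF 0) (hvF 2)))

end Triangulation

/-! ### Finite element subspaces and boundary moments -/

theorem localNedelec_mono {j k : ℕ} (hjk : j ≤ k) : localNedelec j ≤ localNedelec k := by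
  rcases hjk.eq_or_lt with rfl | hlt
  · exact le_rfl
  · intro u hu
    -- For j < k the degree is at most j + 1 ≤ k, so the full polynomial summand already contains
    -- `u`.
    refine Submodule.mem_sup_left fun i _ => ?_
    refine (mem_restrictTotalDegree _ _ _).2 ?_
    have := ((degLT_of_mem_localNedelec hu).1 i).totalDegree_le
    omega

namespace Triangulation

variable {Ω : Set E3} (T : Triangulation Ω)

theorem nedelec_mono {j k : ℕ} (hjk : j ≤ k) : T.nedelec j ≤ T.nedelec k :=
  fun _ hu => ⟨fun K => localNedelec_mono hjk (hu.1 K), hu.2⟩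

/-- `N_{k0}^h` as a subspace. -/
def nedelecZero (k : ℕ) : Submodule ℂ T.Field where
  carrier := T.nedelec0 k
  zero_mem' := ⟨Submodule.zero_mem _, fun F x _ => by
    have : feval ((0 : T.Field) (T.adj F)) x = 0 := funext fun i => by simp [feval, peval]
    rw [this, map_zero, LinearMap.zero_apply]⟩
  add_mem' := by
    rintro u v ⟨hu, hu'⟩ ⟨hv, hv'⟩
    refine ⟨Submodule.add_mem _ hu hv, fun F x hx => ?_⟩
    rw [Pi.add_apply, feval_add, map_add, LinearMap.add_apply, hu' F x hx, hv' F x hx, add_zero]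
  smul_mem' := by
    rintro c u ⟨hu, hu'⟩
    refine ⟨Submodule.smul_mem _ c hu, fun F x hx => ?_⟩
    rw [Pi.smul_apply, feval_smul, map_smul, LinearMap.smul_apply, hu' F x hx, smul_zero]

instance finiteDimensional_nedelecZero (k : ℕ) : FiniteDimensional ℂ (T.nedelecZero k) := by
  let L : T.nedelecZero k →ₗ[ℂ] (T.cells → Fin 3 → restrictTotalDegree (Fin 3) ℂ (k + 1)) :=
    { toFun := fun u K i => ⟨u.1 K i, (mem_restrictTotalDegree _ _ _).2
        ((degLT_of_mem_localNedelec (u.2.1.1 K)).1 i).totalDegree_le⟩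
      map_add' := fun u v => rfl
      map_smul' := fun c u => rfl }
  refine FiniteDimensional.of_injective L fun u v huv => Subtype.ext ?_
  funext K i
  exact congrArg Subtype.val (congrFun (congrFun huv K) i)

theorem sub_mem_nedelecZero {k : ℕ} {u v : T.Field} (hu : u ∈ T.nedelec k) (hv : v ∈ T.nedelec k)
    (h : ∀ F : T.bfaces, ∀ x ∈ hull F.1, feval (u (T.adj F)) x ⨯₃ toC (T.normal F) =
      feval (v (T.adj F)) x ⨯₃ toC (T.normal F)) : u - v ∈ T.nedelecZero k := by
  refine ⟨Submodule.sub_mem _ hu hv, fun F x hx => ?_⟩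
  rw [Pi.sub_apply, feval_sub, map_sub, LinearMap.sub_apply, h F x hx, sub_self]

section Moments

variable {k : ℕ} {z : T.BField} {u u' : T.Field}

theorem segment_subset_hull {F : Finset E3} {a b : E3} (ha : a ∈ F) (hb : b ∈ F) :
    segment ℝ a b ⊆ hull F :=
  segment_subset_convexHull (Finset.mem_coe.2 ha) (Finset.mem_coe.2 hb)

theorem sharesBoundaryMoments_of_cross_eq (hu : u ∈ T.nedelec k)
    (h : ∀ F : T.bfaces, ∀ x ∈ hull F.1, feval (u (T.adj F)) x ⨯₃ toC (T.normal F) =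
      feval (z F) x ⨯₃ toC (T.normal F)) : T.SharesBoundaryMoments k z u := by
  refine ⟨hu, fun F a ha b hb => ⟨fun q _ => ?_, fun q _ => ?_⟩⟩
  · have hm : MeasurableSet (segment ℝ a b) := by
      rw [← convexHull_pair]
      exact ((Set.toFinite {a, b}).isCompact_convexHull ℝ).measurableSet
    refine setIntegral_congr_fun hm fun x hx => ?_
    simp only [T.tangential_eq_of_cross_eq F (h F x (segment_subset_hull ha hb hx)) ha hb]
  · refine setIntegral_congr_fun (isCompact_hull F.1).measurableSet fun x hx => ?_
    simp only [T.tangential_eq_of_cross_eq F (h F x hx) ha hb]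

theorem edgeMoment_sub (v w : PolyField) (a b : E3) (q : MvPolynomial (Fin 3) ℂ) :
    edgeMoment (v - w) a b q = edgeMoment v a b q - edgeMoment w a b q := by
  have hi : ∀ v : PolyField, IntegrableOn
      (fun x => (feval v x ⬝ᵥ toC (b - a)) * peval q x) (segment ℝ a b) μHE[1] := fun v => by
    rw [segment_eq_convexHull_range]
    refine integrableOn_convexHull_range ![a, b] ?_
    simp only [← peval_dirComp]
    exact (continuous_peval _).mul (continuous_peval _)
  rw [edgeMoment, edgeMoment, edgeMoment, ← integral_sub (hi v) (hi w)]
  simp only [feval_sub, sub_dotProduct, sub_mul]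

theorem integrableOn_bface {G : Type*} [NormedAddCommGroup G] (F : T.bfaces) {f : E3 → G}
    (hf : Continuous f) : IntegrableOn f (hull F.1) μHE[2] := by
  obtain ⟨hF, hc⟩ := T.mem_faces_of_bface F
  obtain ⟨v, -, hvr, -⟩ := exists_enumeration hc (T.complex.indep hF)
  rw [hull, ← hvr]
  exact integrableOn_convexHull_range v hf

theorem faceMoment_sub (F : T.bfaces) (v w : PolyField) (a b : E3)
    (q : MvPolynomial (Fin 3) ℂ) :
    faceMoment (v - w) F.1 a b q = faceMoment v F.1 a b q - faceMoment w F.1 a b q := by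
  have hi : ∀ v : PolyField, IntegrableOn
      (fun x => (feval v x ⬝ᵥ toC (b - a)) * peval q x) (hull F.1) μHE[2] := fun v => by
    refine T.integrableOn_bface F ?_
    simp only [← peval_dirComp]
    exact (continuous_peval _).mul (continuous_peval _)
  rw [faceMoment, faceMoment, faceMoment, ← integral_sub (hi v) (hi w)]
  simp only [feval_sub, sub_dotProduct, sub_mul]

/-- Two elements of `N_k^h` with the same boundary moments have the same tangential trace. -/
theorem SharesBoundaryMoments.sub_mem (hu : T.SharesBoundaryMoments k z u)
    (hu' : T.SharesBoundaryMoments k z u') : u - u' ∈ T.nedelecZero k := by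
  have hsub := Submodule.sub_mem _ hu.1 hu'.1
  refine ⟨hsub, fun F x hx => T.cross_normal_eq_zero F ?_⟩
  obtain ⟨hF, hc⟩ := T.mem_faces_of_bface F
  refine tangential_eq_zero_of_moments_eq_zero (hsub.1 (T.adj F)) hc (T.complex.indep hF)
    (fun a ha b hb q hq => ?_) (fun a ha b hb q hq => ?_) x hx
  · rw [Pi.sub_apply, edgeMoment_sub, (hu.2 F a ha b hb).1 q hq, (hu'.2 F a ha b hb).1 q hq,
      sub_self]
  · rw [Pi.sub_apply, T.faceMoment_sub, (hu.2 F a ha b hb).2 q hq, (hu'.2 F a ha b hb).2 q hq,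
      sub_self]

/-- Both branches of the definition share the moments once a single field does. The formula depends
on the lifting only through its trace, so vanishing interior moments are not needed. -/
theorem Lh_sharesBoundaryMoments (h : T.SharesBoundaryMoments k z u) :
    T.SharesBoundaryMoments k z (T.Lh k z) := by
  unfold Lh
  split_ifs with h'
  · exact h'.choose_spec.1
  · exact Classical.epsilon_spec ⟨u, h⟩

end Moments

/-! ### Discrete state, discrete adjoint and the adjoint formula -/

section State

variable {μ κ : E3 → Matrix (Fin 3) (Fin 3) ℝ} {ω : ℝ} {k j : ℕ} {z z' : T.BField}
  {u u' : T.Field}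

theorem IsDiscreteState.add (ha : IsSesq (T.aForm μ κ ω)) (h : T.IsDiscreteState k μ κ ω z u)
    (h' : T.IsDiscreteState k μ κ ω z' u') : T.IsDiscreteState k μ κ ω (z + z') (u + u') := by
  refine ⟨Submodule.add_mem _ h.1 h'.1, fun v hv => ?_, fun F x hx => ?_⟩
  · rw [ha.add_left, h.2.1 v hv, h'.2.1 v hv, add_zero]
  · simp only [Pi.add_apply, feval_add, map_add, LinearMap.add_apply]
    rw [h.2.2 F x hx, h'.2.2 F x hx]

theorem IsDiscreteState.smul (ha : IsSesq (T.aForm μ κ ω)) (c : ℂ)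
    (h : T.IsDiscreteState k μ κ ω z u) : T.IsDiscreteState k μ κ ω (c • z) (c • u) := by
  refine ⟨Submodule.smul_mem _ c h.1, fun v hv => ?_, fun F x hx => ?_⟩
  · rw [ha.smul_left, h.2.1 v hv, mul_zero]
  · simp only [Pi.smul_apply, feval_smul, map_smul, LinearMap.smul_apply]
    rw [h.2.2 F x hx]

theorem IsDiscreteState.unique (ha : IsSesq (T.aForm μ κ ω))
    (hdef : ∀ u, T.aForm μ κ ω u u = 0 → u = 0) (h : T.IsDiscreteState k μ κ ω z u)
    (h' : T.IsDiscreteState k μ κ ω z u') : u = u' := by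
  have hd := T.sub_mem_nedelecZero h.1 h'.1 fun F x hx => (h.2.2 F x hx).trans (h'.2.2 F x hx).symm
  refine sub_eq_zero.1 (hdef _ ?_)
  rw [ha.sub_left, h.2.1 _ hd, h'.2.1 _ hd, sub_zero]

/-- A control is by definition the trace of some u₀ in N_j^h ⊆ N_k^h; a correction in N_{k0}^h
representing -a(u₀, ·) makes it a state. -/
theorem exists_isDiscreteState (ha : IsSesq (T.aForm μ κ ω))
    (hdef : ∀ u, T.aForm μ κ ω u u = 0 → u = 0) (hjk : j ≤ k) (hz : z ∈ T.Zh j) :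
    ∃ u, T.IsDiscreteState k μ κ ω z u := by
  obtain ⟨⟨u₀, hu₀, rfl⟩, -⟩ := hz
  have hg : IsConjLinear fun v => -T.aForm μ κ ω u₀ v :=
    ⟨fun u v => by rw [(ha.right u₀).add]; ring, fun c v => by rw [(ha.right u₀).smul]; ring⟩
  obtain ⟨w, hw, hwa⟩ := ha.exists_represent (T.nedelecZero k) (fun u _ => hdef u) hg
  refine ⟨u₀ + w, Submodule.add_mem _ (T.nedelec_mono hjk hu₀) hw.1, fun v hv => ?_,
    fun F x hx => ?_⟩
  · rw [ha.add_left, hwa v hv, add_neg_cancel]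
  · rw [T.feval_gammaT_cross u₀ F hx, Pi.add_apply, feval_add, map_add, LinearMap.add_apply,
      hw.2 F x hx, add_zero]

theorem isDiscreteState_Sh (ha : IsSesq (T.aForm μ κ ω))
    (hdef : ∀ u, T.aForm μ κ ω u u = 0 → u = 0) (hjk : j ≤ k) (hz : z ∈ T.Zh j) :
    T.IsDiscreteState k μ κ ω z (T.Sh k μ κ ω z) :=
  Classical.epsilon_spec (T.exists_isDiscreteState ha hdef hjk hz)

theorem isConjLinear_innerΩ {f : T.cells → E3 → Fin 3 → ℂ} (hf : IsL2 T.cellMeasure f) :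
    IsConjLinear fun v => T.innerΩ f (T.fn v) where
  add u v := (congrArg (T.innerΩ f) (T.fnLin.map_add u v)).trans
    (l2Inner_add_right hf (T.isL2_feval u) (T.isL2_feval v))
  smul c u := (congrArg (T.innerΩ f) (T.fnLin.map_smul c u)).trans (l2Inner_smul_right c _ _)

theorem existsUnique_isDiscreteAdjoint (ha : IsSesq (T.aForm μ κ ω))
    (hdef : ∀ u, T.aForm μ κ ω u u = 0 → u = 0) {f : T.cells → E3 → Fin 3 → ℂ}
    (hf : IsL2 T.cellMeasure f) : ∃! w, T.IsDiscreteAdjoint k μ κ ω f w := by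
  have ha' : IsSesq (T.aStar μ κ ω) := ha.conj_swap
  have hdef' : ∀ u, T.aStar μ κ ω u u = 0 → u = 0 := fun u hu => hdef u (by
    simpa [aStar] using hu)
  obtain ⟨w, hw, hwa⟩ := ha'.exists_represent (T.nedelecZero k) (fun u _ => hdef' u)
    (T.isConjLinear_innerΩ hf)
  refine ⟨w, ⟨hw, hwa⟩, fun w' hw' => ?_⟩
  have hd : w' - w ∈ T.nedelecZero k := Submodule.sub_mem _ hw'.1 hw
  refine sub_eq_zero.1 (hdef' _ ?_)
  rw [ha'.sub_left, hw'.2 _ hd, hwa _ hd, sub_self]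

/-- Equal boundary moments make `u - l` a test function for the adjoint problem, while `w` is a test
function for the state equation and removes a(u, w). -/
theorem innerΩ_eq_adjointFormula (ha : IsSesq (T.aForm μ κ ω)) {f : T.cells → E3 → Fin 3 → ℂ}
    (hf : IsL2 T.cellMeasure f) {w l : T.Field} (hw : T.IsDiscreteAdjoint k μ κ ω f w)
    (hu : T.IsDiscreteState k μ κ ω z u) (hl : T.SharesBoundaryMoments k z l) :
    T.innerΩ f (T.fn u) = T.adjointFormula μ κ ω f w l := by
  have hd := SharesBoundaryMoments.sub_mem T
    (T.sharesBoundaryMoments_of_cross_eq hu.1 hu.2.2) hl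
  have h1 := hw.2 _ hd
  have h2 := (T.isConjLinear_innerΩ hf).add (u - l) l
  rw [sub_add_cancel] at h2
  rw [h2, ← h1, aStar, ha.sub_left, hu.2.1 w hw.1, zero_sub, map_neg, adjointFormula]

end State

end Triangulation

/-! ### The control space and the cost as a sum of squared norms -/

namespace Triangulation

variable {Ω : Set E3} (T : Triangulation Ω)

theorem normalExt_add (F : T.bfaces) (p q : PolyField) :
    T.normalExt F (p + q) = T.normalExt F p + T.normalExt F q :=
  funext fun i => by simp [normalExt]

theorem normalExt_smul (F : T.bfaces) (c : ℂ) (p : PolyField) :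
    T.normalExt F (c • p) = c • T.normalExt F p :=
  funext fun i => by simp [normalExt]

theorem gammaT_add (u v : T.Field) : T.gammaT (u + v) = T.gammaT u + T.gammaT v := by
  funext F
  simp only [gammaT, Pi.add_apply, normalExt_add, map_add, LinearMap.add_apply]

theorem cross_smul_mvPolynomial (c : ℂ) (p q : PolyField) :
    (c • p) ⨯₃ q = c • (p ⨯₃ q) ∧ p ⨯₃ (c • q) = c • (p ⨯₃ q) := by
  constructor <;> funext i <;> fin_cases i <;> simp [cross_apply, smul_sub]

theorem gammaT_smul (c : ℂ) (u : T.Field) : T.gammaT (c • u) = c • T.gammaT u := by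
  funext F
  simp only [gammaT, Pi.smul_apply, normalExt_smul, (cross_smul_mvPolynomial c _ _).1,
    (cross_smul_mvPolynomial c _ _).2]

theorem surfCurl_add (z y : T.BField) (F : T.bfaces) :
    T.surfCurl (z + y) F = T.surfCurl z F + T.surfCurl y F := by
  simp only [surfCurl, Pi.add_apply, pcurl_add, mul_add, Finset.sum_add_distrib]

theorem surfCurl_smul (c : ℂ) (z : T.BField) (F : T.bfaces) :
    T.surfCurl (c • z) F = c • T.surfCurl z F := by
  simp only [surfCurl, Pi.smul_apply, pcurl_smul, mul_smul_comm, Finset.smul_sum]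

theorem peval_add (p q : MvPolynomial (Fin 3) ℂ) (x : E3) :
    peval (p + q) x = peval p x + peval q x := by simp [peval]

theorem peval_smul (c : ℂ) (p : MvPolynomial (Fin 3) ℂ) (x : E3) :
    peval (c • p) x = c * peval p x := by simp [peval, smul_eval]

/-- The discrete control space as a subspace. -/
def controlSpace (j : ℕ) : Submodule ℂ T.BField where
  carrier := T.Zh j
  zero_mem' := by
    refine ⟨⟨0, Submodule.zero_mem _, ?_⟩, ?_⟩
    · have := T.gammaT_smul 0 0
      rwa [zero_smul, zero_smul] at this
    · refine Finset.sum_eq_zero fun F _ => ?_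
      have h : T.surfCurl 0 F = 0 := by
        have := T.surfCurl_smul 0 0 F
        rwa [zero_smul, zero_smul] at this
      simp [h, peval]
  add_mem' := by
    rintro _ _ ⟨⟨u, hu, rfl⟩, hz⟩ ⟨⟨v, hv, rfl⟩, hy⟩
    refine ⟨⟨u + v, Submodule.add_mem _ hu hv, T.gammaT_add u v⟩, ?_⟩
    rw [← add_zero (0 : ℂ)]
    nth_rewrite 1 [← hz]
    rw [← hy, ← Finset.sum_add_distrib]
    refine Finset.sum_congr rfl fun F _ => ?_
    rw [← integral_add (T.integrableOn_bface F (continuous_peval _))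
      (T.integrableOn_bface F (continuous_peval _))]
    simp only [surfCurl_add, peval_add]
  smul_mem' := by
    rintro c _ ⟨⟨u, hu, rfl⟩, hz⟩
    refine ⟨⟨c • u, Submodule.smul_mem _ c hu, T.gammaT_smul c u⟩, ?_⟩
    rw [← mul_zero c, ← hz, Finset.mul_sum]
    refine Finset.sum_congr rfl fun F _ => ?_
    rw [← integral_const_mul]
    simp only [surfCurl_smul, peval_smul]

/-- Surface measure on the boundary faces. -/
def faceMeasure (F : T.bfaces) : Measure E3 := (μHE[2] : Measure E3).restrict (hull F.1)

instance (F : T.bfaces) : IsFiniteMeasure ((μHE[2] : Measure E3).restrict (hull F.1)) := by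
  obtain ⟨hF, hc⟩ := T.mem_faces_of_bface F
  obtain ⟨v, -, hvr, -⟩ := exists_enumeration hc (T.complex.indep hF)
  refine ⟨?_⟩
  rw [Measure.restrict_apply_univ, hull, ← hvr]
  exact measure_convexHull_range_lt_top v

/-- The function field of a boundary field. -/
def boundaryFn (z : T.BField) : T.bfaces → E3 → Fin 3 → ℂ := fun F x => feval (z F) x

/-- The surface curl of a boundary field, as a field with one component. -/
def boundaryCurl (z : T.BField) : T.bfaces → E3 → Unit → ℂ := fun F x _ => peval (T.surfCurl z F) x

theorem isL2_boundaryFn (z : T.BField) : IsL2 T.faceMeasure (T.boundaryFn z) :=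
  fun F c => memLp_restrict_of_continuous (isCompact_hull F.1) (continuous_peval (z F c))

theorem isL2_boundaryCurl (z : T.BField) : IsL2 T.faceMeasure (T.boundaryCurl z) :=
  fun F _ => memLp_restrict_of_continuous (isCompact_hull F.1) (continuous_peval _)

theorem innerCurlΓ_eq (z y : T.BField) :
    T.innerCurlΓ z y = l2Inner T.faceMeasure (T.boundaryCurl z) (T.boundaryCurl y) := by
  simp [innerCurlΓ, l2Inner, dotProduct, boundaryCurl, faceMeasure]

theorem cost_eq (α β : ℝ) (ud : E3 → Fin 3 → ℂ) (u : T.Field) (z : T.BField) :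
    T.cost α β ud u z = 1 / 2 * l2NormSq T.cellMeasure (T.residual ud u) +
      α / 2 * l2NormSq T.faceMeasure (T.boundaryCurl z) +
      β / 2 * l2NormSq T.faceMeasure (T.boundaryFn z) := by
  simp [cost, l2NormSq, boundaryCurl, boundaryFn, cellMeasure, faceMeasure]

theorem isL2_residual (hreg : interior (closure Ω) = Ω) {ud : E3 → Fin 3 → ℂ}
    (hud : MemLp ud 2 (volume.restrict Ω)) (u : T.Field) :
    IsL2 T.cellMeasure (T.residual ud u) := fun K c =>
  (T.isL2_feval u K c).sub <| ((ContinuousLinearMap.proj (R := ℂ) (φ := fun _ : Fin 3 => ℂ)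
    c).comp_memLp' hud).mono_measure (T.cellMeasure_le hreg K)

/-! ### Quadratic expansion of the cost and the optimality condition -/

section Optimality

variable {μ κ : E3 → Matrix (Fin 3) (Fin 3) ℝ} {ω α β : ℝ} {k j : ℕ} {ud : E3 → Fin 3 → ℂ}

/-- Second-order expansion of the reduced cost functional along a line. -/
theorem reducedCost_add_smul (ha : IsSesq (T.aForm μ κ ω))
    (hdef : ∀ u, T.aForm μ κ ω u u = 0 → u = 0) (hjk : j ≤ k)
    (hr : ∀ u, IsL2 T.cellMeasure (T.residual ud u)) (hα : 0 < α) (hβ : 0 < β)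
    {z d : T.BField} (hz : z ∈ T.Zh j) (hd : d ∈ T.Zh j) :
    ∃ Q : ℝ, 0 ≤ Q ∧ ∀ t : ℝ,
      T.reducedCost k μ κ ω α β ud (z + (t : ℂ) • d) = T.reducedCost k μ κ ω α β ud z +
        t * (T.ShAdjoint k μ κ ω (T.residual ud (T.Sh k μ κ ω z)) d +
          (α : ℂ) * T.innerCurlΓ z d + (β : ℂ) * T.innerΓ z d).re + t ^ 2 * Q := by
  set Su := T.Sh k μ κ ω z with hSu
  set Sd := T.Sh k μ κ ω d with hSd
  -- The quadratic coefficient is the cost of the direction `d` for desired state zero.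
  refine ⟨1 / 2 * l2NormSq T.cellMeasure (T.fn Sd) +
    α / 2 * l2NormSq T.faceMeasure (T.boundaryCurl d) +
    β / 2 * l2NormSq T.faceMeasure (T.boundaryFn d), ?_, fun t => ?_⟩
  · have h1 := l2NormSq_nonneg (ν := T.cellMeasure) (T.fn Sd)
    have h2 := l2NormSq_nonneg (ν := T.faceMeasure) (T.boundaryCurl d)
    have h3 := l2NormSq_nonneg (ν := T.faceMeasure) (T.boundaryFn d)
    positivity
  · have hzd : z + (t : ℂ) • d ∈ T.Zh j :=
      (T.controlSpace j).add_mem hz ((T.controlSpace j).smul_mem (t : ℂ) hd)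
    -- `Sh` is a mere choice of a solution; its linearity comes from uniqueness.
    have hS : T.Sh k μ κ ω (z + (t : ℂ) • d) = Su + (t : ℂ) • Sd :=
      IsDiscreteState.unique T ha hdef (T.isDiscreteState_Sh ha hdef hjk hzd)
        (IsDiscreteState.add T ha (T.isDiscreteState_Sh ha hdef hjk hz)
          (IsDiscreteState.smul T ha (t : ℂ) (T.isDiscreteState_Sh ha hdef hjk hd)))
    have hres : T.residual ud (Su + (t : ℂ) • Sd) = T.residual ud Su + (t : ℂ) • T.fn Sd := by
      funext K x
      simp only [residual, Pi.add_apply, Pi.smul_apply, feval_add, feval_smul, fn]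
      abel
    have hcurl : T.boundaryCurl (z + (t : ℂ) • d) =
        T.boundaryCurl z + (t : ℂ) • T.boundaryCurl d := by
      funext F x i
      simp only [boundaryCurl, surfCurl_add, surfCurl_smul, peval_add, peval_smul, Pi.add_apply,
        Pi.smul_apply, smul_eq_mul]
    have hfn : T.boundaryFn (z + (t : ℂ) • d) = T.boundaryFn z + (t : ℂ) • T.boundaryFn d := by
      funext F x
      simp only [boundaryFn, Pi.add_apply, Pi.smul_apply, feval_add, feval_smul]
    have hΓ : T.innerΓ z d = l2Inner T.faceMeasure (T.boundaryFn z) (T.boundaryFn d) := rfl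
    have hΩ : T.ShAdjoint k μ κ ω (T.residual ud Su) d =
        l2Inner T.cellMeasure (T.residual ud Su) (T.fn Sd) := rfl
    have hSdL : IsL2 T.cellMeasure (T.fn Sd) := T.isL2_feval Sd
    rw [reducedCost, reducedCost, hS, cost_eq, cost_eq, hres, hcurl, hfn,
      ← hSu,
      l2NormSq_add_smul (hr Su) hSdL,
      l2NormSq_add_smul (T.isL2_boundaryCurl z) (T.isL2_boundaryCurl d),
      l2NormSq_add_smul (T.isL2_boundaryFn z) (T.isL2_boundaryFn d), hΩ, hΓ, innerCurlΓ_eq,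
      Complex.add_re, Complex.add_re, Complex.re_ofReal_mul, Complex.re_ofReal_mul]
    ring

theorem eq_zero_of_forall_quadratic_nonneg {g Q : ℝ} (hQ : 0 ≤ Q)
    (h : ∀ t : ℝ, 0 ≤ t * g + t ^ 2 * Q) : g = 0 := by
  -- Near the minimizer -g/(2Q), but with a denominator that stays positive for Q = 0; the value is
  -- -(g/(Q+1))².
  have h1 := h (-g / (Q + 1))
  have hQ1 : 0 < Q + 1 := by linarith
  have h2 : -g / (Q + 1) * g + (-g / (Q + 1)) ^ 2 * Q = -(g / (Q + 1)) ^ 2 := by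
    field_simp
    ring
  rw [h2] at h1
  have h3 : g / (Q + 1) = 0 :=
    (pow_eq_zero_iff two_ne_zero).1 (le_antisymm (by linarith) (sq_nonneg _))
  exact (div_eq_zero_iff.1 h3).resolve_right hQ1.ne'

/-- Steps of both signs along z - zb stay in the subspace Z^h, so the first-order term must vanish,
not merely be nonnegative. Conversely, the expansion at t = 1 leaves only the nonnegative quadratic
term. -/
theorem isMinOn_reducedCost_iff (ha : IsSesq (T.aForm μ κ ω))
    (hdef : ∀ u, T.aForm μ κ ω u u = 0 → u = 0) (hjk : j ≤ k)
    (hr : ∀ u, IsL2 T.cellMeasure (T.residual ud u)) (hα : 0 < α) (hβ : 0 < β)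
    {zb : T.BField} (hzb : zb ∈ T.Zh j) :
    IsMinOn (T.reducedCost k μ κ ω α β ud) (T.Zh j) zb ↔
      ∀ z ∈ T.Zh j,
        (T.ShAdjoint k μ κ ω (T.residual ud (T.Sh k μ κ ω zb)) (z - zb) +
          (α : ℂ) * T.innerCurlΓ zb (z - zb) + (β : ℂ) * T.innerΓ zb (z - zb)).re = 0 := by
  constructor
  · intro hmin z hz
    have hd : z - zb ∈ T.Zh j := (T.controlSpace j).sub_mem hz hzb
    obtain ⟨Q, hQ, hexp⟩ := T.reducedCost_add_smul ha hdef hjk hr hα hβ hzb hd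
    refine eq_zero_of_forall_quadratic_nonneg hQ fun t => ?_
    have h1 := isMinOn_iff.1 hmin _
      ((T.controlSpace j).add_mem hzb ((T.controlSpace j).smul_mem (t : ℂ) hd))
    rw [hexp t] at h1
    linarith
  · intro h
    refine isMinOn_iff.2 fun z hz => ?_
    have hd : z - zb ∈ T.Zh j := (T.controlSpace j).sub_mem hz hzb
    obtain ⟨Q, hQ, hexp⟩ := T.reducedCost_add_smul ha hdef hjk hr hα hβ hzb hd
    have h1 := hexp 1
    rw [h z hz, Complex.ofReal_one, one_smul, add_sub_cancel] at h1
    rw [h1]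
    linarith

end Optimality

end Triangulation

end EddyControl

end

/-! ### The main theorem -/

theorem mainTheorem11 {Ω : Set EddyControl.E3} (hopen : IsOpen Ω) (hconn : IsConnected Ω)
    (hreg : interior (closure Ω) = Ω) (T : EddyControl.Triangulation Ω)
    (μ κ : EddyControl.E3 → Matrix (Fin 3) (Fin 3) ℝ)
    (hμ : EddyControl.IsCoefficient Ω μ) (hκ : EddyControl.IsCoefficient Ω κ)
    (ω : ℝ) (hω : ω ≠ 0) (α β : ℝ) (hα : 0 < α) (hβ : 0 < β)
    (ud : EddyControl.E3 → Fin 3 → ℂ) (hud : MemLp ud 2 (volume.restrict Ω))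
    (k j : ℕ) (hjk : j ≤ k) :
    -- the discrete state equation is uniquely solvable, so that `S_h` is well defined
    (∀ z ∈ T.Zh j, T.IsDiscreteState k μ κ ω z (T.Sh k μ κ ω z) ∧
      ∃! u, T.IsDiscreteState k μ κ ω z u) ∧
    -- the discrete adjoint problem is uniquely solvable
    (∀ z ∈ T.Zh j,
      ∃! w, T.IsDiscreteAdjoint k μ κ ω (T.residual ud (T.Sh k μ κ ω z)) w) ∧
    -- computation of `S_h^*` through the discrete adjoint state and the lifting
    (∀ z ∈ T.Zh j, ∀ w, T.IsDiscreteAdjoint k μ κ ω (T.residual ud (T.Sh k μ κ ω z)) w →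
      ∀ ξ ∈ T.Zh j,
        T.ShAdjoint k μ κ ω (T.residual ud (T.Sh k μ κ ω z)) ξ =
          T.adjointFormula μ κ ω (T.residual ud (T.Sh k μ κ ω z)) w (T.Lh k ξ) ∧
        ∀ l, T.SharesBoundaryMoments k ξ l →
          T.ShAdjoint k μ κ ω (T.residual ud (T.Sh k μ κ ω z)) ξ =
            T.adjointFormula μ κ ω (T.residual ud (T.Sh k μ κ ω z)) w l) ∧
    -- the optimality conditions
    (∀ zb ∈ T.Zh j,
      IsMinOn (T.reducedCost k μ κ ω α β ud) (T.Zh j) zb ↔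
        ∃ ub, ub = T.Sh k μ κ ω zb ∧
          ∀ z ∈ T.Zh j,
            (T.ShAdjoint k μ κ ω (T.residual ud ub) (z - zb) +
              (α : ℂ) * T.innerCurlΓ zb (z - zb) +
              (β : ℂ) * T.innerΓ zb (z - zb)).re = 0) := by
  have ha := T.isSesq_aForm hreg hμ hκ ω
  have hdef : ∀ u, T.aForm μ κ ω u u = 0 → u = 0 := fun u => T.aForm_definite hreg hμ hκ hω
  have hr := T.isL2_residual hreg hud
  have hS : ∀ z ∈ T.Zh j, T.IsDiscreteState k μ κ ω z (T.Sh k μ κ ω z) := fun z hz =>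
    T.isDiscreteState_Sh ha hdef hjk hz
  refine ⟨fun z hz => ⟨hS z hz, T.Sh k μ κ ω z, hS z hz, fun u hu => ?_⟩,
    fun z _ => T.existsUnique_isDiscreteAdjoint ha hdef (hr _), fun z _ w hw ξ hξ => ?_,
    fun zb hzb => ?_⟩
  · exact EddyControl.Triangulation.IsDiscreteState.unique T ha hdef hu (hS z hz)
  · have key : ∀ l, T.SharesBoundaryMoments k ξ l →
        T.ShAdjoint k μ κ ω (T.residual ud (T.Sh k μ κ ω z)) ξ =
          T.adjointFormula μ κ ω (T.residual ud (T.Sh k μ κ ω z)) w l := fun l hl =>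
      T.innerΩ_eq_adjointFormula ha (hr _) hw (hS ξ hξ) hl
    -- The state S_h ξ itself shares the boundary moments of ξ, which is the witness the lifting
    -- requires.
    exact ⟨key _ (T.Lh_sharesBoundaryMoments
      (T.sharesBoundaryMoments_of_cross_eq (hS ξ hξ).1 (hS ξ hξ).2.2)), key⟩
  · rw [T.isMinOn_reducedCost_iff ha hdef hjk hr hα hβ hzb]
    exact ⟨fun h => ⟨_, rfl, h⟩, by rintro ⟨_, rfl, h⟩; exact h⟩
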